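/- Let $\mathbb K=\mathbb C$ (complex Grassmannians) or $\mathbb K=\mathbb R$ (real Grassmannians), let $H$ be a Hilbert space over $\mathbb K$, and let $\mathcal A\subset\mathcal B(H)$ be a norm-closed unital $*$-subalgebra. Let $P\in\mathcal A$ be an orthogonal projection, $P^2=P^*=P$. The tangent space at $P$ of the Grassmannian of $\mathcal A$ is the real Banach space $$T_P=\{X\in\mathcal A:\ X^*=X,\ X=XP+PX\},$$ and the exponential map at $P$ of its canonical connection (the geodesics are the $C^2$ paths $\gamma$ of projections such that the $\gamma$-codiagonal part of $\ddot\gamma$ vanishes) is $\mathrm{Exp}_P(V)=e^{[V,P]}Pe^{-[V,P]}$. The order of $V_0\in T_P$ is the dimension over $\mathbb R$ (possibly $0$ or $\infty$) of $\ker D(\mathrm{Exp}_P)_{V_0}$. Let $V\in T_P$ with $\|V\|=1$, let $F=\{\xi\in H: V^2\xi=\xi\}$ be the fixed-point set of $V^2$, and let $V=U|V|$ be the polar decomposition of $V$ in $\mathcal B(H)$. Assume that $U\in\mathcal A$ and that $\mathcal A$ contains the rank-one operators $\xi\otimes\eta=\langle\eta,\cdot\rangle\xi$ with $\xi,\eta\in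 F$ (which is automatic for the Grassmannian of a Hilbert space, $\mathcal A=\mathcal B(H)$). Let $$d=\dim_{\mathbb K}\bigl(F\cap\operatorname{ran}(1-P)\bigr)\in\{0,1,2,\dots,\infty\},$$ the multiplicity of the eigenvalue $1$ of $|\lambda|$, where $\lambda=PV(1-P)$ is regarded as an operator from $\operatorname{ran}(1-P)$ to $\operatorname{ran}(P)$. Then $\dim_{\mathbb K}F=2d$, the map $\mathrm{Exp}_P$ is differentiable at $\frac{\pi}{2}V$, and the order of $\frac{\pi}{2}V$ is $d^2$ if $\mathbb K=\mathbb C$ and $\frac{d^2-d}{2}$ if $\mathbb K=\mathbb R$ (both read as $\infty$ when $d=\infty$). -/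

import Mathlib

/-! ### Tangent space, connection and exponential map of the Grassmannian of a Banach `*`-algebra -/

section Grassmannian

/-- The tangent space at a projection `P` of the Grassmannian of `A`: the self-adjoint
`P`-codiagonal elements `X`, that is `X = X P + P X`. -/
def tangentSpace {A : Type*} [NormedRing A] [StarRing A] [NormedAlgebra ℝ A] [StarModule ℝ A]
    (P : A) : Submodule ℝ A where
  carrier := {X | star X = X ∧ X = X * P + P * X}
  zero_mem' := by simp
  add_mem' := by
    rintro X Y ⟨hX, hX'⟩ ⟨hY, hY'⟩
    refine ⟨by rw [star_add, hX, hY], ?_⟩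
    rw [add_mul, mul_add, add_add_add_comm, ← hX', ← hY']
  smul_mem' := by
    rintro c X ⟨hX, hX'⟩
    refine ⟨by rw [star_smul, hX, star_trivial], ?_⟩
    rw [smul_mul_assoc, mul_smul_comm, ← smul_add, ← hX']

/-- The projection of `X` onto the `p`-codiagonal elements along the `p`-diagonal ones. -/
def codiagonalPart {A : Type*} [NormedRing A] (p X : A) : A :=
  p * X * (1 - p) + (1 - p) * X * p

/-- The covariant derivative at time `t` of the vector field `X` along the path `γ`: differentiate
in `A` and project onto the tangent space. -/
noncomputable def covariantDeriv {A : Type*} [NormedRing A] [NormedAlgebra ℝ A]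
    (γ X : ℝ → A) (t : ℝ) : A :=
  codiagonalPart (γ t) (deriv X t)

/-- Geodesics of the Grassmannian: paths of projections whose velocity is parallel. -/
structure IsGeodesic {A : Type*} [NormedRing A] [StarRing A] [NormedAlgebra ℝ A]
    (γ : ℝ → A) : Prop where
  contDiff : ContDiff ℝ 2 γ
  isStarProjection : ∀ t, IsStarProjection (γ t)
  parallel : ∀ t, covariantDeriv γ (deriv γ) t = 0

/-- The exponential map of the connection at `P`, `Exp_P(V) = e^{[V,P]} P e^{-[V,P]}`, as a map
from the tangent space at `P` to `A`. -/
noncomputable def expMap {A : Type*} [NormedRing A] [StarRing A] [NormedAlgebra ℝ A]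
    [StarModule ℝ A] (P : A) (V : tangentSpace P) : A :=
  NormedSpace.exp ((V : A) * P - P * (V : A)) * P *
    NormedSpace.exp (-((V : A) * P - P * (V : A)))

/-- `t ↦ Exp_P(tV)` is a geodesic with initial point `P` and initial velocity `V`. -/
theorem isGeodesic_expMap {A : Type*} [NormedRing A] [StarRing A] [NormedAlgebra ℝ A]
    [StarModule ℝ A] [ContinuousStar A] [CompleteSpace A] (P : A) (hP : IsStarProjection P)
    (V : tangentSpace P) :
    IsGeodesic (fun t : ℝ => expMap P (t • V)) ∧ expMap P ((0 : ℝ) • V) = P ∧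
      deriv (fun t : ℝ => expMap P (t • V)) 0 = V := by
  obtain ⟨V, hVs, hV⟩ := V
  have hPs : star P = P := hP.isSelfAdjoint
  have hPP : P * P = P := hP.isIdempotentElem
  have hPVP : P * V * P = 0 := by
    have h : P * V * P = P * (V * P + P * V) * P := by rw [← hV]
    have h2 : P * (V * P + P * V) * P = P * V * P + P * V * P := by
      calc _ = P * V * (P * P) + (P * P) * V * P := by noncomm_ring
        _ = _ := by rw [hPP]
    rw [h2] at h
    simpa using h
  set v : A := V * P - P * V with hv
  have hvs : star v = -v := by simp [hv, hVs, hPs]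
  have hPvP : v * P + P * v = v := by
    calc v * P + P * v = V * (P * P) - (P * P) * V := by rw [hv]; noncomm_ring
      _ = v := by rw [hPP]
  have hvP : v * P - P * v = V := by
    calc v * P - P * v = V * (P * P) - P * V * P - P * V * P + (P * P) * V := by
          rw [hv]; noncomm_ring
      _ = V := by rw [hPP, hPVP, sub_zero, sub_zero, ← hV]
  have hform : (fun t : ℝ => expMap P (t • (⟨V, hVs, hV⟩ : tangentSpace P))) =
      fun t : ℝ => NormedSpace.exp (t • v) * P * NormedSpace.exp (t • (-v)) := by
    funext t
    have h : (t • V) * P - P * (t • V) = t • v := by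
      rw [hv, smul_sub, smul_mul_assoc, mul_smul_comm]
    simp only [expMap, Submodule.coe_smul, h, smul_neg]
  set γ : ℝ → A := fun t => NormedSpace.exp (t • v) * P * NormedSpace.exp (t • (-v)) with hγ
  have hmul : ∀ t : ℝ, NormedSpace.exp (t • (-v)) * NormedSpace.exp (t • v) = 1 := by
    intro t
    let _ : NormedAlgebra ℚ A := NormedAlgebra.restrictScalars ℚ ℝ A
    rw [← NormedSpace.exp_add_of_commute]
    · simp
    · exact ((Commute.refl v).neg_left.smul_left t).smul_right t
  have hd : ∀ t, HasDerivAt γ (v * γ t - γ t * v) t := by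
    intro t
    have h1 := hasDerivAt_exp_smul_const' (𝕂 := ℝ) v t
    have h2 := hasDerivAt_exp_smul_const (𝕂 := ℝ) (-v) t
    have h := (h1.mul_const P).mul h2
    refine h.congr_deriv ?_
    simp only [hγ]
    noncomm_ring
  have hderiv : deriv γ = fun t => v * γ t - γ t * v := funext fun t => (hd t).deriv
  have hcont : Differentiable ℝ γ := fun t => (hd t).differentiableAt
  have hcd : ∀ n : ℕ, ContDiff ℝ n γ := by
    intro n
    induction n with
    | zero => exact contDiff_zero.2 hcont.continuous
    | succ n ih =>
      push_cast
      refine contDiff_succ_iff_deriv.2 ⟨hcont, by simp, ?_⟩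
      rw [hderiv]
      exact (contDiff_const.mul ih).sub (ih.mul contDiff_const)
  have hcomm : ∀ t : ℝ, Commute v (NormedSpace.exp (t • v)) := fun t =>
    Commute.exp_right ((Commute.refl v).smul_right t)
  have hcomm' : ∀ t : ℝ, Commute v (NormedSpace.exp (t • (-v))) := fun t =>
    Commute.exp_right ((Commute.refl v).neg_right.smul_right t)
  have hidem : ∀ t, γ t * γ t = γ t := by
    intro t
    calc γ t * γ t = NormedSpace.exp (t • v) * P *
          (NormedSpace.exp (t • (-v)) * NormedSpace.exp (t • v)) * P *
          NormedSpace.exp (t • (-v)) := by simp only [hγ]; noncomm_ring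
      _ = NormedSpace.exp (t • v) * (P * P) * NormedSpace.exp (t • (-v)) := by
          rw [hmul]; noncomm_ring
      _ = γ t := by rw [hPP]
  have hgvg : ∀ t, v * γ t + γ t * v = v := by
    intro t
    calc v * γ t + γ t * v = (v * NormedSpace.exp (t • v)) * P * NormedSpace.exp (t • (-v)) +
          NormedSpace.exp (t • v) * P * (NormedSpace.exp (t • (-v)) * v) := by
          simp only [hγ]; noncomm_ring
      _ = NormedSpace.exp (t • v) * (v * P + P * v) * NormedSpace.exp (t • (-v)) := by
          rw [(hcomm t).eq, ← (hcomm' t).eq]; noncomm_ring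
      _ = v * (NormedSpace.exp (t • v) * NormedSpace.exp (t • (-v))) := by
          rw [hPvP, ← (hcomm t).eq]; noncomm_ring
      _ = v := by
          have h := hmul (-t)
          rw [neg_smul, smul_neg, neg_neg, neg_smul] at h
          rw [smul_neg, h, mul_one]
  have h0 : γ 0 = P := by simp [hγ]
  refine ⟨?_, ?_, ?_⟩
  · rw [hform]
    refine ⟨by exact_mod_cast hcd 2, fun t => ⟨hidem t, ?_⟩, fun t => ?_⟩
    · change star (γ t) = γ t
      simp only [hγ, star_mul, NormedSpace.star_exp, star_smul, star_neg, hvs, hPs, neg_neg,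
        star_trivial, mul_assoc]
    · have h2 : HasDerivAt (fun t => v * γ t - γ t * v)
          (v * (v * γ t - γ t * v) - (v * γ t - γ t * v) * v) t :=
        ((hd t).const_mul v).sub ((hd t).mul_const v)
      rw [covariantDeriv, hderiv, h2.deriv, codiagonalPart]
      have e1 := hidem t
      have e2 := hgvg t
      generalize γ t = g at e1 e2 ⊢
      have e3 : v * g = v - g * v := eq_sub_of_add_eq e2
      have e4 : v * v * g = g * v * v := by
        rw [mul_assoc, e3, mul_sub, ← mul_assoc, e3]
        noncomm_ring
      have e5 : v * (v * g - g * v) - (v * g - g * v) * v = 4 • (v * v * g) - 2 • (v * v) := by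
        calc _ = v * v * g - 2 • ((v * g) * v) + g * v * v := by noncomm_ring
          _ = v * v * g - 2 • (v * v - g * v * v) + g * v * v := by rw [e3]; noncomm_ring
          _ = _ := by rw [← e4]; abel
      have e6 : g * (4 • (v * v * g) - 2 • (v * v)) = 2 • (v * v * g) := by
        calc _ = 4 • ((g * v * v) * g) - 2 • (g * v * v) := by noncomm_ring
          _ = 4 • (v * v * (g * g)) - 2 • (v * v * g) := by rw [← e4]; noncomm_ring
          _ = _ := by rw [e1]; abel
      rw [e5, e6]
      calc _ = 2 • (v * v * g) - 2 • (v * v * (g * g)) + (4 • (v * v * (g * g)) -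
            2 • (v * v * g)) - (g * (4 • (v * v * g) - 2 • (v * v))) * g := by noncomm_ring
        _ = 0 := by
          rw [e6, smul_mul_assoc, mul_assoc (v * v), e1]; abel
  · have := congrFun hform 0
    exact this.trans h0
  · rw [hform, hderiv]
    simp only [h0, hvP]

/-- Geodesics are determined by their initial point and velocity: `Exp_P(tV)` is the value at time
`t` of the geodesic starting at `P` with velocity `V`. -/
theorem IsGeodesic.eq_expMap {A : Type*} [NormedRing A] [StarRing A] [NormedAlgebra ℝ A]
    [StarModule ℝ A] [CompleteSpace A] {γ : ℝ → A} (hγ : IsGeodesic γ)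
    (V : tangentSpace (γ 0)) (hV : deriv γ 0 = V) (t : ℝ) :
    γ t = expMap (γ 0) (t • V) := by
  have hd : ∀ t, HasDerivAt γ (deriv γ t) t := fun t =>
    ((hγ.contDiff.differentiable (by simp)) t).hasDerivAt
  have hd2 : ∀ t, HasDerivAt (deriv γ) (deriv (deriv γ) t) t := fun t =>
    (((contDiff_succ_iff_deriv (n := 1)).1 (by simpa [one_add_one_eq_two] using hγ.contDiff)).2.2.differentiable
      (by simp) t).hasDerivAt
  have hpp : ∀ t, γ t * γ t = γ t := fun t => (hγ.isStarProjection t).isIdempotentElem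
  have hcod : ∀ t, deriv γ t * γ t + γ t * deriv γ t = deriv γ t := fun t => by
    have h : HasDerivAt (fun t => γ t * γ t) (deriv γ t * γ t + γ t * deriv γ t) t :=
      (hd t).mul (hd t)
    rw [funext hpp] at h
    exact h.unique (hd t)
  have hgdg : ∀ t, γ t * deriv γ t * γ t = 0 := fun t => by
    have h : γ t * deriv γ t * γ t = γ t * (deriv γ t * γ t + γ t * deriv γ t) * γ t := by
      rw [hcod]
    have h2 : γ t * (deriv γ t * γ t + γ t * deriv γ t) * γ t =
        γ t * deriv γ t * γ t + γ t * deriv γ t * γ t := by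
      calc _ = γ t * deriv γ t * (γ t * γ t) + (γ t * γ t) * deriv γ t * γ t := by noncomm_ring
        _ = _ := by rw [hpp]
    rw [h2] at h
    simpa using h
  have hcom : ∀ t, deriv (deriv γ) t * γ t = γ t * deriv (deriv γ) t := fun t => by
    have h := hγ.parallel t
    rw [covariantDeriv, codiagonalPart] at h
    generalize deriv (deriv γ) t = X at h
    have hp := hpp t
    generalize γ t = p at h hp
    have h1 : p * X - p * X * p = 0 := by
      calc p * X - p * X * p = p * X * (1 - p) := by noncomm_ring
        _ = p * (p * X * (1 - p) + (1 - p) * X * p) := by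
            have : p * (1 - p) = 0 := by rw [mul_sub, mul_one, hp, sub_self]
            rw [mul_add, ← mul_assoc, ← mul_assoc, ← mul_assoc, ← mul_assoc, hp, this]
            simp
        _ = 0 := by rw [h, mul_zero]
    have h2 : X * p - p * X * p = 0 := by
      calc X * p - p * X * p = (1 - p) * X * p := by noncomm_ring
        _ = p * X * (1 - p) + (1 - p) * X * p := by
            rw [mul_sub (p * X), mul_one, h1, zero_add]
        _ = 0 := h
    rw [sub_eq_zero.1 h1, sub_eq_zero.1 h2]
  set w : ℝ → A := fun t => deriv γ t * γ t - γ t * deriv γ t with hw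
  have hw' : ∀ t, HasDerivAt w 0 t := fun t => by
    refine (((hd2 t).mul (hd t)).sub ((hd t).mul (hd2 t))).congr_deriv ?_
    rw [hcom]
    abel
  have hwc : ∀ t, w t = w 0 := fun t =>
    is_const_of_deriv_eq_zero (fun t => (hw' t).differentiableAt) (fun t => (hw' t).deriv) t 0
  set v := w 0 with hv
  have hlin : ∀ t, deriv γ t = v * γ t - γ t * v := fun t => by
    rw [← hwc t]
    calc deriv γ t = deriv γ t * γ t + γ t * deriv γ t := (hcod t).symm
      _ = deriv γ t * (γ t * γ t) - γ t * deriv γ t * γ t - γ t * deriv γ t * γ t +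
          (γ t * γ t) * deriv γ t := by rw [hpp, hgdg]; simp
      _ = w t * γ t - γ t * w t := by simp only [hw]; noncomm_ring
  have hmul : ∀ t : ℝ, NormedSpace.exp (t • v) * NormedSpace.exp (t • (-v)) = 1 := by
    intro t
    let _ : NormedAlgebra ℚ A := NormedAlgebra.restrictScalars ℚ ℝ A
    rw [← NormedSpace.exp_add_of_commute]
    · simp
    · exact ((Commute.refl v).neg_right.smul_left t).smul_right t
  set δ : ℝ → A := fun t => NormedSpace.exp (t • (-v)) * γ t * NormedSpace.exp (t • v) with hδ
  have hδ' : ∀ t, HasDerivAt δ 0 t := fun t => by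
    have h1 := hasDerivAt_exp_smul_const (𝕂 := ℝ) (-v) t
    have h2 := hasDerivAt_exp_smul_const' (𝕂 := ℝ) v t
    refine ((h1.mul (hd t)).mul h2).congr_deriv ?_
    simp only [Pi.mul_apply, hlin]
    noncomm_ring
  have hδc : δ t = γ 0 := by
    have h : δ t = δ 0 :=
      is_const_of_deriv_eq_zero (fun t => (hδ' t).differentiableAt) (fun t => (hδ' t).deriv) t 0
    rw [h]
    simp [hδ]
  have hvV : (t • (V : A)) * γ 0 - γ 0 * (t • (V : A)) = t • v := by
    rw [hv, hw, smul_mul_assoc, mul_smul_comm, ← smul_sub, ← hV]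
  rw [expMap, Submodule.coe_smul, hvV, ← hδc, ← smul_neg]
  calc γ t = 1 * γ t * 1 := by simp
    _ = (NormedSpace.exp (t • v) * NormedSpace.exp (t • (-v))) * γ t *
        (NormedSpace.exp (t • v) * NormedSpace.exp (t • (-v))) := by rw [hmul]
    _ = _ := by simp only [hδ]; noncomm_ring

/-- The order of `V` as a tangent conjugate point to `P`: the real dimension of the kernel of the
differential of `Exp_P` at `V` (with value `⊤` if it is infinite). -/
noncomputable def conjugateOrder {A : Type*} [NormedRing A] [StarRing A] [NormedAlgebra ℝ A]
    [StarModule ℝ A] (P : A) (V : tangentSpace P) : ℕ∞ :=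
  Cardinal.toENat (Module.rank ℝ (LinearMap.ker (fderiv ℝ (expMap P) V).toLinearMap))

end Grassmannian

/-! ### Operators on Hilbert spaces -/

section Operators

/-- `T = U W` is the polar decomposition of `T`: `W = |T|` is the positive square root of `T* T`
and `U` is the partial isometry with the same kernel as `T`. -/
structure IsPolarDecomposition {𝕜 H : Type*} [RCLike 𝕜] [NormedAddCommGroup H]
    [InnerProductSpace 𝕜 H] [CompleteSpace H] (T U W : H →L[𝕜] H) : Prop where
  isPositive : W.IsPositive
  sq_eq : W * W = star T * T
  partialIsometry : U * star U * U = U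
  eq_mul : T = U * W
  ker_eq : LinearMap.ker U.toLinearMap = LinearMap.ker T.toLinearMap

/-- The fixed-point set of `T`. -/
def fixedSpace {𝕜 H : Type*} [RCLike 𝕜] [NormedAddCommGroup H] [InnerProductSpace 𝕜 H]
    (T : H →L[𝕜] H) : Submodule 𝕜 H :=
  LinearMap.eqLocus T.toLinearMap LinearMap.id

/-- The dimension of a subspace over the field of scalars (`⊤` if it is infinite). -/
noncomputable def eDim {𝕜 H : Type*} [RCLike 𝕜] [NormedAddCommGroup H] [InnerProductSpace 𝕜 H]
    (S : Submodule 𝕜 H) : ℕ∞ :=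
  Cardinal.toENat (Module.rank 𝕜 S)

end Operators

/-!
# The order of the first tangent conjugate point in the Grassmannian of an operator algebra

Let `ε = 2P - 1`. A tangent vector `V` anticommutes with `ε`, hence so does `v = [V, P] = Vε`, and
`Exp_P(V) = (1 + e^{2v} ε) / 2` (`expMap_eq`). So `X` lies in the kernel of `D(Exp_P)` at
`(π/2) V` if and only if `x = [X, P]` lies in the kernel of the derivative of `exp` at `π v`, which
by Duhamel's formula means that `y(s) = e^{-sv} x e^{sv}` has integral zero over `[-π/2, π/2]`.

*From the integral to an algebraic equation.* Put `z = [v, [v, x]] + 4x`, so that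
`e^{-sv} z e^{sv} = y'' + 4y`. Integrating by parts twice against the weight `1 + cos 2s`, which
vanishes to second order at `±π/2` and satisfies `w'' + 4w = 4`, gives
`∫ (1 + cos 2s) e^{-sv} z e^{sv} ds = 4 ∫ y`. If the left side vanishes then `z = 0`: as `v` is
skew-adjoint with `‖v‖ ≤ 1`, the first-order Taylor polynomial of `e^{-sv} z e^{sv}` has error at
most `2s²‖z‖`, and integration yields `π‖z‖ ≤ (π³/6 - π)‖z‖`, while `π² < 12`. Rewritten in terms
of `V` and `X`, the kernel is given by `[V, [V, X]] = 4X`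
(`fderiv_expMap_pi_div_two_smul_eq_zero_iff`).

*Solving the equation.* The operators `Y = [V, X] ± 2X` satisfy `[V, Y] = ±2Y`. For such `Y` and a
self-adjoint contraction `V`, the sequence `‖Y V^n ξ‖²` is convex and bounded, hence nonincreasing,
and `2‖Yξ‖ ≤ ‖VYξ‖ + ‖YVξ‖` makes it nondecreasing; being constant it forces `Y V² = Y`, and
then `V Y = ±Y`, `Y V = ∓Y`. Therefore `[V, [V, X]] = 4X` is equivalent to `V² X = X` together with
`X V = -V X` (`double_commutator_eq_iff`).

*Counting dimensions.* Such an `X` lives on the fixed space `F` of `V²` and exchanges `F ∩ ran P`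
with `F₁ = F ∩ ker P`, so it is determined by the operator `V X` on `F₁`, which is skew-adjoint.
Conversely a skew-adjoint finite-rank operator `b` on `F₁` belongs to the algebra and comes from
`X = V b - b V`. Thus for an orthonormal family of `n` vectors in `F₁` the matrix of `V X` maps the
kernel onto the skew-adjoint `n × n` matrices, and injectively if the family spans `F₁`
(`tangentMatrix_surjective`, `tangentMatrix_injective`). Finally `V` maps `F₁` isomorphically onto
`F ∩ ran P`, so `dim F = 2 dim F₁` (`eDim_fixedSpace_sq`).
-/

/-! ### The derivative of the exponential in a Banach algebra -/

open NormedSpace in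
theorem exp_neg_smul_mul_exp_smul {A : Type*} [NormedRing A] [NormedAlgebra ℝ A] [CompleteSpace A]
    (v : A) (t : ℝ) : exp (-t • v) * exp (t • v) = 1 := by
  let _ : NormedAlgebra ℚ A := NormedAlgebra.restrictScalars ℚ ℝ A
  rw [← exp_add_of_commute (((Commute.refl v).smul_left _).smul_right _), ← add_smul]
  simp

open NormedSpace in
theorem exp_add_smul {A : Type*} [NormedRing A] [NormedAlgebra ℝ A] [CompleteSpace A]
    (v : A) (s t : ℝ) : exp ((s + t) • v) = exp (s • v) * exp (t • v) := by
  let _ : NormedAlgebra ℚ A := NormedAlgebra.restrictScalars ℚ ℝ A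
  rw [← exp_add_of_commute (((Commute.refl v).smul_left _).smul_right _), ← add_smul]

theorem continuous_exp_of_real {A : Type*} [NormedRing A] [NormedAlgebra ℝ A] [CompleteSpace A] :
    Continuous (NormedSpace.exp : A → A) := by
  let _ : NormedAlgebra ℚ A := NormedAlgebra.restrictScalars ℚ ℝ A
  exact NormedSpace.exp_continuous

open NormedSpace in
/-- Duhamel's formula: integrate the derivative of `s ↦ e^{(1-s)a} e^{sb}`. -/
theorem integral_exp_mul_sub_mul_exp {A : Type*} [NormedRing A] [NormedAlgebra ℝ A]
    [CompleteSpace A] (a b : A) :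
    ∫ s in (0 : ℝ)..1, exp ((1 - s) • a) * (b - a) * exp (s • b) = exp b - exp a := by
  have hc : Continuous (exp : A → A) := continuous_exp_of_real
  have h : ∀ s : ℝ, HasDerivAt (fun s : ℝ => exp ((1 - s) • a) * exp (s • b))
      (exp ((1 - s) • a) * (b - a) * exp (s • b)) s := fun s => by
    have h1 := (hasDerivAt_exp_smul_const (𝕂 := ℝ) a (1 - s)).scomp s
      ((hasDerivAt_id s).const_sub 1)
    refine (h1.mul (hasDerivAt_exp_smul_const' (𝕂 := ℝ) b s)).congr_deriv ?_
    simp only [Function.comp_apply, neg_smul, one_smul]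
    noncomm_ring
  rw [intervalIntegral.integral_eq_sub_of_hasDerivAt (fun s _ => h s)
    (Continuous.intervalIntegrable (by fun_prop) _ _)]
  simp

theorem differentiable_exp_of_real {A : Type*} [NormedRing A] [NormedAlgebra ℝ A]
    [CompleteSpace A] : Differentiable ℝ (NormedSpace.exp : A → A) := fun a =>
  (NormedSpace.exp_analytic (𝕂 := ℝ) a).differentiableAt

open NormedSpace Filter Topology in
theorem fderiv_exp_apply {A : Type*} [NormedRing A] [NormedAlgebra ℝ A] [CompleteSpace A]
    (a x : A) :
    fderiv ℝ exp a x = ∫ s in (0 : ℝ)..1, exp ((1 - s) • a) * x * exp (s • a) := by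
  have hc : Continuous (exp : A → A) := continuous_exp_of_real
  set I : ℝ → A := fun t => ∫ s in (0 : ℝ)..1, exp ((1 - s) • a) * x * exp (s • (a + t • x))
  have hI : Continuous I :=
    intervalIntegral.continuous_parametric_intervalIntegral_of_continuous
      (by simp only [Function.uncurry_def]; fun_prop) continuous_const
  have hquot : ∀ t : ℝ, exp (a + t • x) - exp a = t • I t := fun t => by
    rw [← integral_exp_mul_sub_mul_exp, ← intervalIntegral.integral_smul]
    simp
  have h1 : HasDerivAt (fun t : ℝ => exp (a + t • x)) (fderiv ℝ exp a x) 0 := by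
    have h := (differentiable_exp_of_real a).hasFDerivAt
    have h2 : HasDerivAt (fun t : ℝ => a + t • x) x 0 := by
      simpa using ((hasDerivAt_id (0 : ℝ)).smul_const x).const_add a
    have h3 : HasFDerivAt exp (fderiv ℝ exp a) (a + (0 : ℝ) • x) := by simpa using h
    exact h3.comp_hasDerivAt 0 h2
  have h2 : HasDerivAt (fun t : ℝ => exp (a + t • x)) (I 0) 0 := by
    rw [hasDerivAt_iff_tendsto_slope_zero]
    refine (hI.tendsto 0 |>.mono_left nhdsWithin_le_nhds).congr' ?_
    filter_upwards [self_mem_nhdsWithin] with t ht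
    have ht' : t ≠ 0 := ht
    simp only [zero_add, zero_smul, add_zero]
    rw [hquot, smul_smul, inv_mul_cancel₀ ht', one_smul]
  rw [h1.unique h2]
  simp [I]

open NormedSpace in
open Real (pi_ne_zero) in
open scoped Real in
/-- Up to multiplication by the invertible element `e^{(π/2)v}` on both sides, the derivative of
`exp` at `πv` is the average of the conjugates of `x` over the symmetric interval. -/
theorem fderiv_exp_pi_smul_eq_zero_iff {A : Type*} [NormedRing A] [NormedAlgebra ℝ A]
    [CompleteSpace A] (v x : A) :
    fderiv ℝ exp (π • v) x = 0 ↔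
      ∫ s in (-(π / 2))..(π / 2), exp (-s • v) * x * exp (s • v) = 0 := by
  have hc : Continuous (exp : A → A) := continuous_exp_of_real
  have hf : ∀ s : ℝ, exp ((1 - s) • π • v) * x * exp (s • π • v) =
      exp ((π / 2) • v) * (exp (-(π * s - π / 2) • v) * x * exp ((π * s - π / 2) • v)) *
        exp ((π / 2) • v) := fun s => by
    rw [smul_smul, smul_smul, show (1 - s) * π = π / 2 + -(π * s - π / 2) by ring,
      show s * π = (π * s - π / 2) + π / 2 by ring, exp_add_smul, exp_add_smul]
    noncomm_ring
  have hL : ∀ y : A, exp ((π / 2) • v) * y * exp ((π / 2) • v) = 0 ↔ y = 0 := fun y => by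
    refine ⟨fun h => ?_, fun h => by simp [h]⟩
    have h1 := exp_neg_smul_mul_exp_smul v (π / 2)
    have h2 := exp_neg_smul_mul_exp_smul v (-(π / 2))
    rw [neg_neg] at h2
    calc y = (exp (-(π / 2) • v) * exp ((π / 2) • v)) * y *
          (exp ((π / 2) • v) * exp (-(π / 2) • v)) := by rw [h1, h2]; simp
      _ = exp (-(π / 2) • v) * (exp ((π / 2) • v) * y * exp ((π / 2) • v)) *
          exp (-(π / 2) • v) := by noncomm_ring
      _ = 0 := by rw [h]; simp
  have hint : IntervalIntegrable
      (fun s : ℝ => exp (-(π * s - π / 2) • v) * x * exp ((π * s - π / 2) • v))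
      MeasureTheory.volume 0 1 := Continuous.intervalIntegrable (by fun_prop) _ _
  have key : fderiv ℝ exp (π • v) x = exp ((π / 2) • v) *
      (π⁻¹ • ∫ s in (-(π / 2))..(π / 2), exp (-s • v) * x * exp (s • v)) *
        exp ((π / 2) • v) := by
    have hcv := intervalIntegral.integral_comp_mul_sub (a := 0) (b := 1)
      (fun s : ℝ => exp (-s • v) * x * exp (s • v)) pi_ne_zero (π / 2)
    rw [show π * 0 - π / 2 = -(π / 2) by ring, show π * 1 - π / 2 = π / 2 by ring] at hcv
    rw [fderiv_exp_apply, ← hcv]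
    simp only [hf]
    have h1 := ((ContinuousLinearMap.mul ℝ A).flip (exp ((π / 2) • v))).intervalIntegral_comp_comm
      (hint.const_mul (exp ((π / 2) • v)))
    have h2 := (ContinuousLinearMap.mul ℝ A (exp ((π / 2) • v))).intervalIntegral_comp_comm
      hint
    simp only [ContinuousLinearMap.flip_apply, ContinuousLinearMap.mul_apply'] at h1 h2
    rw [h1, h2]
  rw [key, hL, smul_eq_zero]
  simp [pi_ne_zero]

/-! ### The kernel of the derivative of the exponential at a skew-adjoint element -/

open NormedSpace in
theorem hasDerivAt_exp_conj {A : Type*} [NormedRing A] [NormedAlgebra ℝ A] [CompleteSpace A]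
    (v z : A) (s : ℝ) :
    HasDerivAt (fun s : ℝ => exp (-s • v) * z * exp (s • v))
      (exp (-s • v) * (z * v - v * z) * exp (s • v)) s := by
  have h1 := (hasDerivAt_exp_smul_const (𝕂 := ℝ) v (-s)).scomp s (hasDerivAt_neg s)
  refine ((h1.mul_const z).mul (hasDerivAt_exp_smul_const' (𝕂 := ℝ) v s)).congr_deriv ?_
  simp only [Function.comp_apply, neg_smul, one_smul]
  noncomm_ring

open NormedSpace in
open scoped Real in
/-- Two integrations by parts against the weight `1 + cos 2s`. Together with its derivative it
vanishes at `±π/2`, so there are no boundary terms. -/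
theorem integral_one_add_cos_smul_exp_conj {A : Type*} [NormedRing A] [NormedAlgebra ℝ A]
    [CompleteSpace A] (v x : A) :
    ∫ s in (-(π / 2))..(π / 2), (1 + Real.cos (2 * s)) • (exp (-s • v) *
        ((x * v - v * x) * v - v * (x * v - v * x) + (4 : ℝ) • x) * exp (s • v)) =
      (4 : ℝ) • ∫ s in (-(π / 2))..(π / 2), exp (-s • v) * x * exp (s • v) := by
  have hc : Continuous (exp : A → A) := continuous_exp_of_real
  set y := x * v - v * x with hy
  have hG : ∀ s : ℝ, HasDerivAt (fun s : ℝ =>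
      (1 + Real.cos (2 * s)) • (exp (-s • v) * y * exp (s • v)) +
        (2 * Real.sin (2 * s)) • (exp (-s • v) * x * exp (s • v)))
      ((1 + Real.cos (2 * s)) • (exp (-s • v) * (y * v - v * y + (4 : ℝ) • x) * exp (s • v)) -
        (4 : ℝ) • (exp (-s • v) * x * exp (s • v))) s := fun s => by
    have hd : HasDerivAt (fun s : ℝ => 2 * s) 2 s := by
      simpa using (hasDerivAt_id s).const_mul (2 : ℝ)
    have h1 := (hd.cos.const_add 1).smul (hasDerivAt_exp_conj v y s)
    have h2 := (hd.sin.const_mul 2).smul (hasDerivAt_exp_conj v x s)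
    refine (h1.add h2).congr_deriv ?_
    rw [← hy]
    simp only [mul_add, add_mul, mul_smul_comm, smul_mul_assoc]
    module
  have h := intervalIntegral.integral_eq_sub_of_hasDerivAt (a := -(π / 2)) (b := π / 2)
    (fun s _ => hG s) (Continuous.intervalIntegrable (by fun_prop) _ _)
  rw [intervalIntegral.integral_sub (Continuous.intervalIntegrable (by fun_prop) _ _)
    (Continuous.intervalIntegrable (by fun_prop) _ _), intervalIntegral.integral_smul,
    show 2 * (π / 2) = π by ring, show 2 * -(π / 2) = -π by ring] at h
  rw [← sub_eq_zero, h]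
  simp

open NormedSpace in
theorem norm_exp_smul_le_one {A : Type*} [NormedRing A] [StarRing A] [CStarRing A]
    [NormedAlgebra ℝ A] [StarModule ℝ A] [CompleteSpace A] {v : A} (hv : star v = -v) (s : ℝ) :
    ‖exp (s • v)‖ ≤ 1 := by
  have h : star (exp (s • v)) * exp (s • v) = 1 := by
    rw [star_exp, star_smul, hv, star_trivial, smul_neg, ← neg_smul,
      exp_neg_smul_mul_exp_smul]
  rcases subsingleton_or_nontrivial A with _ | _
  · simp [Subsingleton.elim (exp (s • v)) 0]
  · have h2 := CStarRing.norm_star_mul_self (x := exp (s • v))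
    rw [h, CStarRing.norm_one] at h2
    nlinarith [norm_nonneg (exp (s • v))]

open NormedSpace in
theorem norm_exp_conj_le {A : Type*} [NormedRing A] [StarRing A] [CStarRing A]
    [NormedAlgebra ℝ A] [StarModule ℝ A] [CompleteSpace A] {v : A} (hv : star v = -v) (z : A)
    (s : ℝ) : ‖exp (-s • v) * z * exp (s • v)‖ ≤ ‖z‖ := by
  refine (norm_mul_le_of_le (norm_mul_le_of_le (norm_exp_smul_le_one hv _) le_rfl)
    (norm_exp_smul_le_one hv _)).trans (by simp)

theorem norm_mul_sub_mul_le {A : Type*} [NormedRing A] {v : A} (hv : ‖v‖ ≤ 1) (z : A) :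
    ‖z * v - v * z‖ ≤ 2 * ‖z‖ := by
  have h1 : ‖z * v‖ ≤ ‖z‖ * 1 := norm_mul_le_of_le le_rfl hv
  have h2 : ‖v * z‖ ≤ 1 * ‖z‖ := norm_mul_le_of_le hv le_rfl
  linarith [norm_sub_le (z * v) (v * z)]

open NormedSpace in
/-- The first-order Taylor estimate: conjugation by `e^{sv}` is contractive, so the second
derivative is bounded by `‖[v, [v, z]]‖ ≤ 4‖z‖`. -/
theorem norm_exp_conj_sub_sub_le {A : Type*} [NormedRing A] [StarRing A] [CStarRing A]
    [NormedAlgebra ℝ A] [StarModule ℝ A] [CompleteSpace A] {v : A} (hv : star v = -v)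
    (hv1 : ‖v‖ ≤ 1) (z : A) (s : ℝ) :
    ‖exp (-s • v) * z * exp (s • v) - (z + s • (z * v - v * z))‖ ≤ 2 * s ^ 2 * ‖z‖ := by
  -- conjugation by `e^{sv}` is unchanged under `(v, s) ↦ (-v, -s)`
  wlog hs : 0 ≤ s generalizing v s
  · have h := this (v := -v) (by rw [star_neg, hv]) (by rwa [norm_neg]) (-s) (by linarith)
    have e : z * -v - -v * z = -(z * v - v * z) := by noncomm_ring
    simp only [e, smul_neg, neg_smul, neg_neg, neg_sq] at h
    rwa [neg_smul]
  have h1 : ∀ y : A, ∀ t : ℝ, 0 ≤ t →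
      ‖exp (-t • v) * y * exp (t • v) - y‖ ≤ 2 * ‖y‖ * t := fun y t ht => by
    have := Convex.norm_image_sub_le_of_norm_hasDerivWithin_le (s := Set.univ)
      (fun u _ => (hasDerivAt_exp_conj v y u).hasDerivWithinAt)
      (fun u _ => (norm_exp_conj_le hv _ u).trans (norm_mul_sub_mul_le hv1 y))
      convex_univ (Set.mem_univ 0) (Set.mem_univ t)
    simpa [abs_of_nonneg ht] using this
  have hd : ∀ t : ℝ, HasDerivAt
      (fun t : ℝ => exp (-t • v) * z * exp (t • v) - (z + t • (z * v - v * z)))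
      (exp (-t • v) * (z * v - v * z) * exp (t • v) - (z * v - v * z)) t := fun t => by
    have h2 := ((hasDerivAt_id t).smul_const (z * v - v * z)).const_add z
    rw [one_smul] at h2
    exact (hasDerivAt_exp_conj v z t).sub h2
  have hB : ∀ t : ℝ, HasDerivAt (fun t : ℝ => 2 * t ^ 2 * ‖z‖) (4 * ‖z‖ * t) t := fun t => by
    refine (((hasDerivAt_pow 2 t).const_mul 2).mul_const ‖z‖).congr_deriv ?_
    push_cast
    ring
  refine image_norm_le_of_norm_deriv_right_le_deriv_boundary (a := 0) (b := s)
    (fun t _ => (hd t).continuousAt.continuousWithinAt) (fun t _ => (hd t).hasDerivWithinAt)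
    (by simp) hB (fun t ht => (h1 _ t ht.1).trans ?_) ⟨hs, le_rfl⟩
  have := mul_le_mul_of_nonneg_right (norm_mul_sub_mul_le hv1 z) ht.1
  linarith

open scoped Real in
theorem integral_one_add_cos_mul_sq :
    ∫ s in (-(π / 2))..(π / 2), (1 + Real.cos (2 * s)) * (2 * s ^ 2) = π ^ 3 / 6 - π := by
  have hG : ∀ s : ℝ, HasDerivAt (fun s : ℝ => 2 / 3 * s ^ 3 + s ^ 2 * Real.sin (2 * s) +
      s * Real.cos (2 * s) - Real.sin (2 * s) / 2)
      ((1 + Real.cos (2 * s)) * (2 * s ^ 2)) s := fun s => by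
    have hd : HasDerivAt (fun s : ℝ => 2 * s) 2 s := by
      simpa using (hasDerivAt_id s).const_mul (2 : ℝ)
    refine (((((hasDerivAt_pow 3 s).const_mul (2 / 3)).add
      ((hasDerivAt_pow 2 s).mul hd.sin)).add ((hasDerivAt_id s).mul hd.cos)).sub
      (hd.sin.div_const 2)).congr_deriv ?_
    push_cast
    simp only [id]
    ring
  rw [intervalIntegral.integral_eq_sub_of_hasDerivAt (fun s _ => hG s)
    (Continuous.intervalIntegrable (by fun_prop) _ _),
    show 2 * (π / 2) = π by ring, show 2 * -(π / 2) = -π by ring]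
  simp
  ring

open scoped Real in
theorem integral_one_add_cos_smul_affine {E : Type*} [NormedAddCommGroup E] [NormedSpace ℝ E]
    [CompleteSpace E] (z w : E) :
    ∫ s in (-(π / 2))..(π / 2), (1 + Real.cos (2 * s)) • (z + s • w) = π • z := by
  have hG : ∀ s : ℝ, HasDerivAt (fun s : ℝ => (s + Real.sin (2 * s) / 2) • z +
      (s ^ 2 / 2 + s * Real.sin (2 * s) / 2 + Real.cos (2 * s) / 4) • w)
      ((1 + Real.cos (2 * s)) • (z + s • w)) s := fun s => by
    have hd : HasDerivAt (fun s : ℝ => 2 * s) 2 s := by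
      simpa using (hasDerivAt_id s).const_mul (2 : ℝ)
    refine ((((hasDerivAt_id s).add (hd.sin.div_const 2)).smul_const z).add
      (((((hasDerivAt_pow 2 s).div_const 2).add
        (((hasDerivAt_id s).mul hd.sin).div_const 2)).add
        (hd.cos.div_const 4)).smul_const w)).congr_deriv ?_
    push_cast
    simp only [id]
    module
  rw [intervalIntegral.integral_eq_sub_of_hasDerivAt (fun s _ => hG s)
    (Continuous.intervalIntegrable (by fun_prop) _ _),
    show 2 * (π / 2) = π by ring, show 2 * -(π / 2) = -π by ring]
  simp
  module

open NormedSpace in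
open scoped Real in
/-- The weight `1 + cos 2s` is nonnegative and so concentrated near `0` that a vanishing weighted
average of the conjugates of `z` forces `z = 0`. The bound `π² < 12` is what makes the Taylor error
smaller than the main term. -/
theorem eq_zero_of_integral_one_add_cos_smul_exp_conj {A : Type*} [NormedRing A] [StarRing A]
    [CStarRing A] [NormedAlgebra ℝ A] [StarModule ℝ A] [CompleteSpace A] {v : A}
    (hv : star v = -v) (hv1 : ‖v‖ ≤ 1) {z : A}
    (h : ∫ s in (-(π / 2))..(π / 2), (1 + Real.cos (2 * s)) •
      (exp (-s • v) * z * exp (s • v)) = 0) : z = 0 := by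
  have hc : Continuous (exp : A → A) := continuous_exp_of_real
  have hpi := Real.pi_pos
  have h1 : ∫ s in (-(π / 2))..(π / 2), (1 + Real.cos (2 * s)) •
      (exp (-s • v) * z * exp (s • v) - (z + s • (z * v - v * z))) = -(π • z) := by
    simp only [smul_sub (1 + Real.cos _)]
    rw [intervalIntegral.integral_sub (Continuous.intervalIntegrable (by fun_prop) _ _)
      (Continuous.intervalIntegrable (by fun_prop) _ _), h, integral_one_add_cos_smul_affine,
      zero_sub]
  have h2 : ‖∫ s in (-(π / 2))..(π / 2), (1 + Real.cos (2 * s)) •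
      (exp (-s • v) * z * exp (s • v) - (z + s • (z * v - v * z)))‖ ≤
      ∫ s in (-(π / 2))..(π / 2), (1 + Real.cos (2 * s)) * (2 * s ^ 2) * ‖z‖ := by
    refine intervalIntegral.norm_integral_le_of_norm_le (by linarith) (.of_forall fun s _ => ?_)
      (Continuous.intervalIntegrable (by fun_prop) _ _)
    have h3 : 0 ≤ 1 + Real.cos (2 * s) := by linarith [Real.neg_one_le_cos (2 * s)]
    rw [norm_smul, Real.norm_of_nonneg h3, mul_assoc (1 + _)]
    exact mul_le_mul_of_nonneg_left (norm_exp_conj_sub_sub_le hv hv1 z s) h3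
  rw [h1, intervalIntegral.integral_mul_const, integral_one_add_cos_mul_sq, norm_neg, norm_smul,
    Real.norm_of_nonneg hpi.le] at h2
  have h4 : 0 < π - (π ^ 3 / 6 - π) := by
    have := Real.pi_lt_d2
    have h5 : π ^ 2 < 12 := by nlinarith
    nlinarith
  have h6 : (π - (π ^ 3 / 6 - π)) * ‖z‖ ≤ 0 := by linarith
  exact norm_eq_zero.1 (le_antisymm (nonpos_of_mul_nonpos_right h6 h4) (norm_nonneg z))

open NormedSpace in
open scoped Real in
/-- For skew-adjoint `v` with `‖v‖ ≤ 1`, the spectrum of `ad v` lies in `[-2i, 2i]`, where the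
symbol of the derivative of `exp` at `πv` vanishes only at `±2i`: the kernel is that
of `(ad v)² + 4`. -/
theorem fderiv_exp_pi_smul_eq_zero_iff_of_star_eq_neg {A : Type*} [NormedRing A] [StarRing A]
    [CStarRing A] [NormedAlgebra ℝ A] [StarModule ℝ A] [CompleteSpace A] {v : A}
    (hv : star v = -v) (hv1 : ‖v‖ ≤ 1) (x : A) :
    fderiv ℝ exp (π • v) x = 0 ↔
      (x * v - v * x) * v - v * (x * v - v * x) + (4 : ℝ) • x = 0 := by
  rw [fderiv_exp_pi_smul_eq_zero_iff]
  have h := integral_one_add_cos_smul_exp_conj v x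
  refine ⟨fun h0 => ?_, fun h0 => ?_⟩
  · rw [h0, smul_zero] at h
    exact eq_zero_of_integral_one_add_cos_smul_exp_conj hv hv1 h
  · rw [h0] at h
    simpa using h.symm

/-! ### The derivative of the exponential map of the Grassmannian -/

/-- The map `X ↦ [X, P]` on the tangent space at `P`. -/
noncomputable def tangentCommutator {A : Type*} [NormedRing A] [StarRing A] [NormedAlgebra ℝ A]
    [StarModule ℝ A] (P : A) : tangentSpace P →L[ℝ] A :=
  ((ContinuousLinearMap.mul ℝ A).flip P - ContinuousLinearMap.mul ℝ A P) ∘L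
    (tangentSpace P).subtypeL

theorem tangentCommutator_apply {A : Type*} [NormedRing A] [StarRing A] [NormedAlgebra ℝ A]
    [StarModule ℝ A] (P : A) (X : tangentSpace P) :
    tangentCommutator P X = X * P - P * X := rfl

open NormedSpace in
/-- Since `ε = 2P - 1` anticommutes with `v = [V, P]`, the symmetry `e^v ε e^{-v}` is `e^{2v} ε`. -/
theorem expMap_eq {A : Type*} [NormedRing A] [StarRing A] [NormedAlgebra ℝ A]
    [StarModule ℝ A] [CompleteSpace A] {P : A} (hP : IsIdempotentElem P) (V : tangentSpace P) :
    expMap P V = (2⁻¹ : ℝ) •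
      (1 + exp ((2 : ℝ) • tangentCommutator P V) * ((2 : ℝ) • P - 1)) := by
  let _ : NormedAlgebra ℚ A := NormedAlgebra.restrictScalars ℚ ℝ A
  have hPP : P * P = P := hP
  set v : A := V * P - P * V with hv
  have hsemi : SemiconjBy ((2 : ℝ) • P - 1) (-v) v := by
    have h1 : v * P + P * v = v := by
      calc v * P + P * v = V * (P * P) - (P * P) * V := by rw [hv]; noncomm_ring
        _ = v := by rw [hPP]
    change ((2 : ℝ) • P - 1) * -v = v * ((2 : ℝ) • P - 1)
    rw [← sub_eq_zero]
    calc _ = (2 : ℝ) • (v - (v * P + P * v)) := by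
          simp only [sub_mul, mul_sub, smul_mul_assoc, mul_smul_comm, mul_neg, one_mul, mul_one]
          module
      _ = 0 := by rw [h1, sub_self, smul_zero]
  have h2 : P = (2⁻¹ : ℝ) • (1 + ((2 : ℝ) • P - 1)) := by simp [smul_smul]
  have h3 : exp v * exp (-v) = 1 := by
    simpa using exp_neg_smul_mul_exp_smul v (-1)
  rw [tangentCommutator_apply, ← hv, expMap, ← hv]
  calc exp v * P * exp (-v) =
      (2⁻¹ : ℝ) • (exp v * exp (-v) + exp v * (((2 : ℝ) • P - 1) * exp (-v))) := by
        conv_lhs => rw [h2]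
        rw [mul_smul_comm, smul_mul_assoc, mul_add, add_mul, mul_one, mul_assoc (exp v)]
    _ = _ := by
        rw [hsemi.exp_right.eq, h3, ← mul_assoc, ← exp_add_of_commute (Commute.refl v),
          ← two_smul ℝ v]

theorem hasFDerivAt_expMap {A : Type*} [NormedRing A] [StarRing A] [NormedAlgebra ℝ A]
    [StarModule ℝ A] [CompleteSpace A] {P : A} (hP : IsIdempotentElem P) (V : tangentSpace P) :
    HasFDerivAt (expMap P) ((ContinuousLinearMap.mul ℝ A).flip ((2 : ℝ) • P - 1) ∘L
      fderiv ℝ NormedSpace.exp ((2 : ℝ) • tangentCommutator P V) ∘L tangentCommutator P) V := by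
  have h1 : HasFDerivAt (fun W => (2 : ℝ) • tangentCommutator P W)
      ((2 : ℝ) • tangentCommutator P) V := ((2 : ℝ) • tangentCommutator P).hasFDerivAt
  have h2 := (differentiable_exp_of_real ((2 : ℝ) • tangentCommutator P V)).hasFDerivAt.comp V h1
  have h3 := ((((ContinuousLinearMap.mul ℝ A).flip ((2 : ℝ) • P - 1)).hasFDerivAt.comp V
    h2).const_add 1).const_smul (2⁻¹ : ℝ)
  rw [funext (expMap_eq hP)]
  refine h3.congr_fderiv ?_
  ext X
  simp [smul_smul]

open scoped Real in
/-- The kernel of `D(Exp_P)` at `(π/2) V` is the set of tangent vectors `X` with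
`[V, [V, X]] = 4X`. -/
theorem fderiv_expMap_pi_div_two_smul_eq_zero_iff {A : Type*} [NormedRing A] [StarRing A]
    [CStarRing A] [NormedAlgebra ℝ A] [StarModule ℝ A] [CompleteSpace A] {P : A}
    (hP : IsStarProjection P) {V : tangentSpace P} (hV : ‖V‖ ≤ 1) (X : tangentSpace P) :
    fderiv ℝ (expMap P) ((π / 2) • V) X = 0 ↔
      (V : A) * (V * X - X * V) - (V * X - X * V) * V = (4 : ℝ) • (X : A) := by
  obtain ⟨V, hVs, hVc⟩ := V
  obtain ⟨X, hXs, hXc⟩ := X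
  have hPP : P * P = P := hP.isIdempotentElem
  have hPs : star P = P := hP.isSelfAdjoint
  set e : A := (2 : ℝ) • P - 1 with he
  have hee : e * e = 1 := by
    simp only [he, sub_mul, mul_sub, smul_mul_assoc, mul_smul_comm, hPP, mul_one, one_mul]
    module
  have hes : star e = e := by simp [he, hPs]
  have hanti : ∀ Y : A, Y = Y * P + P * Y → e * Y = -(Y * e) ∧ Y * P - P * Y = Y * e := by
    intro Y hY
    have h3 : (2 : ℝ) • Y = (2 : ℝ) • (Y * P) + (2 : ℝ) • (P * Y) := by rw [← smul_add, ← hY]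
    constructor
    · rw [← sub_eq_zero, he]
      simp only [sub_mul, mul_sub, smul_mul_assoc, mul_smul_comm, one_mul, mul_one]
      calc _ = (2 : ℝ) • (Y * P) + (2 : ℝ) • (P * Y) - (2 : ℝ) • Y := by module
        _ = 0 := by rw [h3, sub_self]
    · rw [he, mul_sub, mul_smul_comm, mul_one, two_smul, eq_sub_iff_add_eq]
      calc Y * P - P * Y + Y = Y * P - P * Y + (Y * P + P * Y) := by rw [← hY]
        _ = Y * P + Y * P := by abel
  obtain ⟨hVe, hVP⟩ := hanti V hVc
  obtain ⟨hXe, hXP⟩ := hanti X hXc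
  have hvs : star (V * e) = -(V * e) := by rw [star_mul, hes, hVs, hVe]
  have he1 : ‖e‖ ≤ 1 := by
    rcases subsingleton_or_nontrivial A with _ | _
    · simp [Subsingleton.elim e 0]
    · have h2 := CStarRing.norm_star_mul_self (x := e)
      rw [hes, hee, CStarRing.norm_one] at h2
      nlinarith [norm_nonneg e]
  have hv1 : ‖V * e‖ ≤ 1 := (norm_mul_le_of_le hV he1).trans (by simp)
  rw [(hasFDerivAt_expMap hP.isIdempotentElem _).fderiv, map_smul, smul_smul,
    show (2 : ℝ) * (π / 2) = π by ring]
  simp only [ContinuousLinearMap.comp_apply, ContinuousLinearMap.flip_apply,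
    ContinuousLinearMap.mul_apply', tangentCommutator_apply, hVP, hXP]
  have hcancel : ∀ Y : A, Y * e = 0 ↔ Y = 0 := fun Y => by
    refine ⟨fun h => ?_, fun h => by simp [h]⟩
    rw [← mul_one Y, ← hee, ← mul_assoc, h, zero_mul]
  rw [hcancel, fderiv_exp_pi_smul_eq_zero_iff_of_star_eq_neg hvs hv1]
  have h4 : (X * e * (V * e) - V * e * (X * e)) * (V * e) -
      V * e * (X * e * (V * e) - V * e * (X * e)) + (4 : ℝ) • (X * e) =
      ((4 : ℝ) • X - (V * (V * X - X * V) - (V * X - X * V) * V)) * e := by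
    have a1 : X * e * (V * e) = -(X * V) := by
      calc X * e * (V * e) = X * (e * V) * e := by noncomm_ring
        _ = -(X * V * (e * e)) := by rw [hVe]; noncomm_ring
        _ = _ := by rw [hee, mul_one]
    have a2 : V * e * (X * e) = -(V * X) := by
      calc V * e * (X * e) = V * (e * X) * e := by noncomm_ring
        _ = -(V * X * (e * e)) := by rw [hXe]; noncomm_ring
        _ = _ := by rw [hee, mul_one]
    have a3 : e * (V * X - X * V) = (V * X - X * V) * e := by
      calc e * (V * X - X * V) = (e * V) * X - (e * X) * V := by noncomm_ring
        _ = X * (e * V) - V * (e * X) := by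
          rw [hVe, hXe, neg_mul, neg_mul, mul_assoc, mul_assoc, hVe, hXe]; noncomm_ring
        _ = _ := by rw [hVe, hXe, sub_mul, mul_neg, mul_neg, mul_assoc, mul_assoc]; abel
    rw [a1, a2]
    calc _ = (V * X - X * V) * V * e - V * (e * (V * X - X * V)) + (4 : ℝ) • (X * e) := by
          noncomm_ring
      _ = _ := by 
          rw [a3]
          generalize V * X - X * V = Y
          rw [sub_mul, sub_mul, smul_mul_assoc, mul_assoc V Y e]
          abel
  rw [h4, hcancel, sub_eq_zero]
  exact eq_comm

/-! ### Commutation equations for a self-adjoint contraction -/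

theorem le_of_convex_of_bddAbove {a : ℕ → ℝ} {C : ℝ} (hC : ∀ n, a n ≤ C)
    (h : ∀ n, 2 * a (n + 1) ≤ a n + a (n + 2)) : a 1 ≤ a 0 := by
  by_contra! hlt
  have h1 : ∀ n, a 1 - a 0 ≤ a (n + 1) - a n := fun n => by
    induction n with
    | zero => simp
    | succ n ih => linarith [h n]
  have h2 : ∀ n : ℕ, a 0 + n * (a 1 - a 0) ≤ a n := fun n => by
    induction n with
    | zero => simp
    | succ n ih => push_cast; linarith [h1 n]
  obtain ⟨n, hn⟩ := exists_nat_gt ((C - a 0) / (a 1 - a 0))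
  rw [div_lt_iff₀ (by linarith)] at hn
  linarith [h2 n, hC n]

/-- If `[V, Y] = 2Y` for a self-adjoint contraction `V`, then `Y* Y` commutes with `V`; hence
`‖Y V^n ξ‖²` is a convex bounded sequence. It is also nondecreasing, hence constant, and
expanding `‖Yξ - Y V² ξ‖²` gives `Y V² = Y`. No spectral theorem is
needed, so the scalars may be real. -/
theorem mul_mul_eq_self_of_commutator_eq {𝕜 H : Type*} [RCLike 𝕜] [NormedAddCommGroup H]
    [InnerProductSpace 𝕜 H] [CompleteSpace H] {V Y : H →L[𝕜] H} (hV : star V = V)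
    (hV1 : ‖V‖ ≤ 1) (h : V * Y - Y * V = (2 : 𝕜) • Y) : Y * V * V = Y := by
  have hs : star Y * V - V * star Y = (2 : 𝕜) • star Y := by
    have := congrArg star h
    simpa [hV] using this
  have hT : V * (star Y * Y) = star Y * Y * V := by
    rw [sub_eq_iff_eq_add] at h
    rw [sub_eq_iff_eq_add, ← sub_eq_iff_eq_add'] at hs
    rw [← mul_assoc, ← hs, sub_mul, mul_assoc, h, mul_add, smul_mul_assoc, mul_smul_comm,
      mul_assoc]
    abel
  have hinner : ∀ x y : H, inner 𝕜 (Y x) (Y y) = inner 𝕜 x ((star Y * Y) y) := fun x y => by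
    rw [ContinuousLinearMap.star_eq_adjoint, mul_apply_eq_comp,
      ContinuousLinearMap.adjoint_inner_right]
  have hVinner : ∀ x y : H, inner 𝕜 (V x) y = inner 𝕜 x (V y) := fun x y => by
    conv_rhs => rw [← hV]
    rw [ContinuousLinearMap.star_eq_adjoint, ContinuousLinearMap.adjoint_inner_right]
  have hpar : ∀ x : H, ‖Y x - Y (V (V x))‖ ^ 2 =
      ‖Y x‖ ^ 2 - 2 * ‖Y (V x)‖ ^ 2 + ‖Y (V (V x))‖ ^ 2 := fun x => by
    have h1 : inner 𝕜 (Y x) (Y (V (V x))) = inner 𝕜 (Y (V x)) (Y (V x)) := by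
      rw [hinner, hinner, hVinner, ← mul_apply_eq_comp V (star Y * Y), hT]
      rfl
    rw [norm_sub_sq (𝕜 := 𝕜), h1, inner_self_eq_norm_sq]
  have hVle : ∀ x : H, ‖V x‖ ≤ ‖x‖ := fun x => by
    simpa using V.le_of_opNorm_le hV1 x
  have hle : ∀ x : H, ‖Y (V x)‖ ≤ ‖Y x‖ := fun x => by
    have hb : ∀ n : ℕ, ‖(V ^ n) x‖ ≤ ‖x‖ := fun n => by
      induction n with
      | zero => simp
      | succ n ih => rw [pow_succ']; exact (hVle _).trans ih
    have := le_of_convex_of_bddAbove (a := fun n => ‖Y ((V ^ n) x)‖ ^ 2)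
      (C := (‖Y‖ * ‖x‖) ^ 2)
      (fun n => pow_le_pow_left₀ (norm_nonneg _) (Y.le_opNorm_of_le (hb n)) 2)
      (fun n => by
        have h1 := hpar ((V ^ n) x)
        have h2 := sq_nonneg ‖Y ((V ^ n) x) - Y (V (V ((V ^ n) x)))‖
        have e1 : (V ^ (n + 1)) x = V ((V ^ n) x) := by rw [pow_succ']; rfl
        have e2 : (V ^ (n + 2)) x = V (V ((V ^ n) x)) := by
          rw [pow_succ', pow_succ']; rfl
        rw [e1, e2]
        linarith)
    exact (sq_le_sq₀ (norm_nonneg _) (norm_nonneg _)).1 (by simpa using this)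
  have hge : ∀ x : H, ‖Y x‖ ≤ ‖Y (V x)‖ := fun x => by
    have h1 : V (Y x) - Y (V x) = (2 : 𝕜) • Y x := congrArg (fun T : H →L[𝕜] H => T x) h
    have h2 := norm_sub_le (V (Y x)) (Y (V x))
    rw [h1, norm_smul, RCLike.norm_ofNat] at h2
    linarith [hVle (Y x)]
  have heq : ∀ x : H, ‖Y (V x)‖ = ‖Y x‖ := fun x => le_antisymm (hle x) (hge x)
  ext x
  have h1 := hpar x
  rw [heq, heq] at h1
  have h2 : ‖Y x - Y (V (V x))‖ = 0 := by
    rw [← sq_eq_zero_iff, h1, heq]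
    ring
  exact (sub_eq_zero.1 (norm_eq_zero.1 h2)).symm

/-- An eigenoperator of `ad V` for the extreme value `2` maps the `-1`-eigenspace of `V` to the
`1`-eigenspace and vanishes on the orthogonal complement of the former. -/
theorem mul_eq_of_commutator_eq {𝕜 H : Type*} [RCLike 𝕜] [NormedAddCommGroup H]
    [InnerProductSpace 𝕜 H] [CompleteSpace H] {V Y : H →L[𝕜] H} (hV : star V = V)
    (hV1 : ‖V‖ ≤ 1) (h : V * Y - Y * V = (2 : 𝕜) • Y) : V * Y = Y ∧ Y * V = -Y := by
  have h1 := mul_mul_eq_self_of_commutator_eq hV hV1 h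
  have hs : -V * star Y - star Y * -V = (2 : 𝕜) • star Y := by
    have := congrArg star h
    rw [star_sub, star_mul, star_mul, hV, star_smul, RCLike.star_def, map_ofNat] at this
    rw [← this]
    noncomm_ring
  have h2 := mul_mul_eq_self_of_commutator_eq (by rw [star_neg, hV]) (by rwa [norm_neg]) hs
  have h3 : V * (V * Y) = Y := by
    have := congrArg star h2
    simpa [hV] using this
  have h4 : V * Y = Y * V + (2 : 𝕜) • Y := by rw [← h]; abel
  have h5 : Y + (2 : 𝕜) • (Y * V) + (2 : 𝕜) • (Y * V + (2 : 𝕜) • Y) = Y := by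
    conv_rhs => rw [← h3, h4, mul_add, mul_smul_comm, ← mul_assoc, h4, add_mul, h1,
      smul_mul_assoc]
  have h6 : Y * V = -Y := by
    linear_combination (norm := module) (1 / 4 : 𝕜) • h5
  refine ⟨?_, h6⟩
  rw [h4, h6]
  module

/-- Split `4X` as the difference of `[V, X] + 2X` and `[V, X] - 2X`, which are eigenoperators of
`ad V` for the values `2` and `-2`. -/
theorem double_commutator_eq_iff {𝕜 H : Type*} [RCLike 𝕜] [NormedAddCommGroup H]
    [InnerProductSpace 𝕜 H] [CompleteSpace H] {V X : H →L[𝕜] H} (hV : star V = V)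
    (hV1 : ‖V‖ ≤ 1) :
    V * (V * X - X * V) - (V * X - X * V) * V = (4 : 𝕜) • X ↔
      V * V * X = X ∧ X * V = -(V * X) := by
  refine ⟨fun h => ?_, fun ⟨h1, h2⟩ => ?_⟩
  · set D := V * X - X * V with hD
    obtain ⟨h1, h2⟩ := mul_eq_of_commutator_eq (Y := D + (2 : 𝕜) • X) hV hV1 (by
      calc _ = V * D - D * V + (2 : 𝕜) • D := by
            rw [mul_add, add_mul, mul_smul_comm, smul_mul_assoc, hD, smul_sub]; abel
        _ = _ := by rw [h]; module)
    obtain ⟨h3, h4⟩ := mul_eq_of_commutator_eq (V := -V) (Y := D - (2 : 𝕜) • X)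
      (by rw [star_neg, hV]) (by rwa [norm_neg]) (by
      calc _ = -(V * D - D * V) + (2 : 𝕜) • D := by
            rw [mul_sub, sub_mul, mul_smul_comm, smul_mul_assoc, hD, neg_mul, neg_mul, mul_neg,
              mul_neg]
            module
        _ = _ := by rw [h]; module)
    rw [mul_add, mul_smul_comm] at h1
    rw [add_mul, smul_mul_assoc] at h2
    rw [neg_mul, mul_sub, mul_smul_comm] at h3
    rw [mul_neg, sub_mul, smul_mul_assoc] at h4
    have h5 : (2 : 𝕜) • (V * X) = D := by
      linear_combination (norm := module) (1 / 2 : 𝕜) • h1 + (1 / 2 : 𝕜) • h3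
    have h6 : (2 : 𝕜) • (X * V) = -D := by
      linear_combination (norm := module) (1 / 2 : 𝕜) • h2 + (1 / 2 : 𝕜) • h4
    have h7 : V * D = (2 : 𝕜) • X := by
      linear_combination (norm := module) (1 / 2 : 𝕜) • h1 - (1 / 2 : 𝕜) • h3
    constructor
    · have h8 : (2 : 𝕜) • (V * V * X) = (2 : 𝕜) • X := by
        rw [mul_assoc, ← mul_smul_comm, h5, h7]
      linear_combination (norm := module) (1 / 2 : 𝕜) • h8
    · linear_combination (norm := module) (1 / 2 : 𝕜) • h5 + (1 / 2 : 𝕜) • h6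
  · have h3 : X * V * V = X := by rw [h2, neg_mul, mul_assoc, h2, mul_neg, neg_neg, ← mul_assoc, h1]
    have h4 : V * X * V = -X := by rw [mul_assoc, h2, mul_neg, ← mul_assoc, h1]
    rw [mul_sub, sub_mul, ← mul_assoc, ← mul_assoc, h1, h3, h4]
    module

/-! ### Skew-adjoint matrices -/

/-- Multiplication by `i` exchanges self-adjoint and skew-adjoint matrices, so each has half of the
real dimension `2n²`. -/
theorem finrank_skewAdjoint_matrix_complex (n : ℕ) :
    Module.finrank ℝ (skewAdjoint (Matrix (Fin n) (Fin n) ℂ)) = n ^ 2 := by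
  have h1 := (StarModule.decomposeProdAdjoint ℝ (Matrix (Fin n) (Fin n) ℂ)).finrank_eq
  have hinj : ∀ c : ℂ, c ≠ 0 → Function.Injective
      (fun M : Matrix (Fin n) (Fin n) ℂ => c • M) := fun c hc => smul_right_injective _ hc
  let f : skewAdjoint (Matrix (Fin n) (Fin n) ℂ) ≃ₗ[ℝ] selfAdjoint (Matrix (Fin n) (Fin n) ℂ) :=
    LinearEquiv.ofBijective skewAdjoint.negISMul
      ⟨fun x y h => Subtype.ext (hinj (-Complex.I) (by simp) (congrArg Subtype.val h)),
        fun y => ⟨⟨Complex.I • (y : Matrix (Fin n) (Fin n) ℂ), by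
          rw [skewAdjoint.mem_iff, star_smul, y.2.star_eq]; simp⟩,
          Subtype.ext (by simp [skewAdjoint.negISMul_apply_coe, smul_smul])⟩⟩
  have : Module.Finite ℝ (selfAdjoint (Matrix (Fin n) (Fin n) ℂ) ×
      skewAdjoint (Matrix (Fin n) (Fin n) ℂ)) :=
    Module.Finite.equiv (StarModule.decomposeProdAdjoint ℝ (Matrix (Fin n) (Fin n) ℂ))
  have := Module.Finite.of_surjective (LinearMap.fst ℝ (selfAdjoint (Matrix (Fin n) (Fin n) ℂ))
    (skewAdjoint (Matrix (Fin n) (Fin n) ℂ))) Prod.fst_surjective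
  have := Module.Finite.of_surjective (LinearMap.snd ℝ (selfAdjoint (Matrix (Fin n) (Fin n) ℂ))
    (skewAdjoint (Matrix (Fin n) (Fin n) ℂ))) Prod.snd_surjective
  rw [Module.finrank_prod, ← f.finrank_eq, Module.finrank_matrix] at h1
  simp at h1
  nlinarith

/-- A real skew-symmetric matrix is determined by its entries above the diagonal. -/
def skewAdjointMatrixEquiv (n : ℕ) :
    skewAdjoint (Matrix (Fin n) (Fin n) ℝ) ≃ₗ[ℝ] ((j : Fin n) × Fin j → ℝ) where
  toFun M p := (M : Matrix (Fin n) (Fin n) ℝ) (Fin.castLE p.1.2.le p.2) p.1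
  map_add' _ _ := rfl
  map_smul' _ _ := rfl
  invFun g := ⟨Matrix.of fun i j => if h : i < j then g ⟨j, ⟨i, h⟩⟩ else
    if h : j < i then -g ⟨i, ⟨j, h⟩⟩ else 0, by
      rw [skewAdjoint.mem_iff]
      ext i j
      rcases lt_trichotomy i j with h | rfl | h
      · simp [h, h.not_gt]
      · simp
      · simp [h, h.not_gt]⟩
  left_inv M := by
    have hM : ∀ i j, (M : Matrix (Fin n) (Fin n) ℝ) j i = -(M : Matrix (Fin n) (Fin n) ℝ) i j :=
      fun i j => congrFun (congrFun
        ((skewAdjoint.mem_iff (R := Matrix (Fin n) (Fin n) ℝ)).1 M.2) i) j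
    ext i j
    rcases lt_trichotomy i j with h | rfl | h
    · simp [h]
    · have := hM i i
      simp
      linarith
    · have := hM j i
      simp [h, h.not_gt, this]
  right_inv g := by
    ext ⟨j, i⟩
    have h : Fin.castLE j.2.le i < j := i.2
    simp [h]

theorem two_mul_finrank_skewAdjoint_matrix_real (n : ℕ) :
    2 * Module.finrank ℝ (skewAdjoint (Matrix (Fin n) (Fin n) ℝ)) = n * (n - 1) := by
  rw [(skewAdjointMatrixEquiv n).finrank_eq, Module.finrank_fintype_fun_eq_card,
    Fintype.card_sigma, mul_comm, ← Finset.sum_range_id_mul_two]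
  simp [Fin.sum_univ_eq_sum_range (fun i => i) n]

/-! ### The fixed space of the square of a tangent vector -/

/-- The square of a codiagonal element is diagonal. -/
theorem mul_mul_eq_of_codiagonal {R : Type*} [Ring R] {P V : R} (hV : V = V * P + P * V) :
    P * (V * V) = V * V * P := by
  have h1 : P * V = V - V * P := eq_sub_of_add_eq' hV.symm
  have h2 : V * P = V - P * V := eq_sub_of_add_eq hV.symm
  rw [← mul_assoc, h1, sub_mul, mul_assoc V P V, mul_assoc V V P, h2, mul_sub]

/-- The fixed space `F` of `V²` is reduced by `P`, and `V` exchanges the two summands, so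
`ξ ↦ (ξ - Pξ, V P ξ)` identifies `F` with two copies of `F ∩ ker P`. -/
theorem eDim_fixedSpace_sq {𝕜 H : Type*} [RCLike 𝕜] [NormedAddCommGroup H]
    [InnerProductSpace 𝕜 H] {P V : H →L[𝕜] H} (hP : P * P = P) (hV : V = V * P + P * V) :
    eDim (fixedSpace (V ^ 2)) =
      2 * eDim (fixedSpace (V ^ 2) ⊓ LinearMap.ker P.toLinearMap) := by
  have hPP : ∀ x, P (P x) = P x := fun x => congrArg (fun T : H →L[𝕜] H => T x) hP
  have hVx : ∀ x, V x = V (P x) + P (V x) := fun x => congrArg (fun T : H →L[𝕜] H => T x) hV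
  have hPVP : ∀ x, P (V (P x)) = 0 := fun x => by simpa [hPP] using hVx (P x)
  have hPVV : ∀ x, P (V (V x)) = V (V (P x)) := fun x =>
    congrArg (fun T : H →L[𝕜] H => T x) (mul_mul_eq_of_codiagonal hV)
  have hF : ∀ x, x ∈ fixedSpace (V ^ 2) ↔ V (V x) = x := fun x => by
    rw [sq]; rfl
  set F₁ := fixedSpace (V ^ 2) ⊓ LinearMap.ker P.toLinearMap with hF₁
  have hmem : ∀ x, x ∈ F₁ ↔ V (V x) = x ∧ P x = 0 := fun x => by
    rw [hF₁, Submodule.mem_inf, hF]; rfl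
  let e : fixedSpace (V ^ 2) ≃ₗ[𝕜] F₁ × F₁ :=
    { toFun := fun x => (⟨(x : H) - P x, (hmem _).2 ⟨by
          rw [map_sub, map_sub, ← hPVV, (hF _).1 x.2], by rw [map_sub, hPP, sub_self]⟩⟩,
        ⟨V (P x), (hmem _).2 ⟨by rw [← hPVV x, (hF _).1 x.2], hPVP _⟩⟩)
      map_add' := fun x y => by
        ext <;> simp; abel
      map_smul' := fun c x => by
        ext <;> simp [smul_sub]
      invFun := fun p => ⟨(p.1 : H) + V p.2, (hF _).2 (by
        rw [map_add, map_add, ((hmem _).1 p.1.2).1, ((hmem _).1 p.2.2).1])⟩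
      left_inv := fun x => by
        ext
        simp only [← hPVV, (hF _).1 x.2]
        abel
      right_inv := fun p => by
        obtain ⟨⟨a, ha⟩, ⟨b, hb⟩⟩ := p
        obtain ⟨ha1, ha2⟩ := (hmem _).1 ha
        obtain ⟨hb1, hb2⟩ := (hmem _).1 hb
        have h1 : P (V b) = V b := by simpa [hb2] using (hVx b).symm
        ext
        · simp [ha2, h1]
        · simp [ha2, h1, hb1] }
  rw [eDim, eDim, e.rank_eq, rank_prod', map_add, two_mul]

/-! ### Tangent vectors anticommuting with a given one -/

/-- The hypotheses say that `b` is a skew-adjoint operator supported on `ker P`, so that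
`V b - b V` is self-adjoint and codiagonal. -/
theorem commutator_mem_tangentSpace {A : Type*} [NormedRing A] [StarRing A] [NormedAlgebra ℝ A]
    [StarModule ℝ A] {P b : A} (hP : IsStarProjection P) (V : tangentSpace P) (hbs : star b = -b)
    (hPb : P * b = 0) : (V : A) * b - b * V ∈ tangentSpace P := by
  obtain ⟨V, hVs, hVc⟩ := V
  have hPs : star P = P := hP.isSelfAdjoint
  have hbP : b * P = 0 := by
    have := congrArg star hPb
    simpa [hbs, hPs] using this
  have h1 : P * (V * b) = V * b := by
    conv_rhs => rw [hVc, add_mul, mul_assoc, hPb, mul_zero, zero_add]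
    rw [mul_assoc]
  have h2 : b * V * P = b * V := by
    conv_rhs => rw [hVc, mul_add, ← mul_assoc b P, hbP, zero_mul, add_zero]
    rw [mul_assoc]
  refine ⟨?_, ?_⟩
  · change star (V * b - b * V) = V * b - b * V
    rw [star_sub, star_mul, star_mul, hbs, hVs]
    noncomm_ring
  · change V * b - b * V = (V * b - b * V) * P + P * (V * b - b * V)
    rw [sub_mul, mul_sub, h1, h2, mul_assoc V, hbP, ← mul_assoc P b, hPb, mul_zero, zero_mul]
    abel

theorem mul_commutator_eq {A : Type*} [Ring A] [StarRing A] {V b : A} (hVs : star V = V)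
    (hbs : star b = -b) (hb : V * V * b = b) :
    V * V * (V * b - b * V) = V * b - b * V ∧
      (V * b - b * V) * V = -(V * (V * b - b * V)) := by
  have hb' : b * V * V = b := by
    have := congrArg star hb
    simpa [hbs, hVs, mul_assoc] using this
  constructor
  · rw [mul_sub, ← mul_assoc _ b, hb, mul_assoc V V (V * b), ← mul_assoc V V b, hb]
  · rw [sub_mul, mul_sub, hb', ← mul_assoc V V b, hb, mul_assoc]
    abel

theorem mul_mul_commutator_eq {A : Type*} [Ring A] [StarRing A] {P V b : A} (hPs : star P = P)
    (hVc : V = V * P + P * V) (hbs : star b = -b) (hPb : P * b = 0) (hb : V * V * b = b) :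
    V * (V * b - b * V) = b - V * b * V * P := by
  have hbP : b * P = 0 := by
    have := congrArg star hPb
    simpa [hbs, hPs] using this
  have h : b * V = b * V * P := by
    conv_lhs => rw [hVc, mul_add, ← mul_assoc b P, hbP, zero_mul, add_zero]
    rw [mul_assoc]
  rw [mul_sub, ← mul_assoc, hb, h, ← mul_assoc, ← mul_assoc]

open InnerProductSpace in
theorem star_sum_smul_rankOne {𝕜 H : Type*} [RCLike 𝕜] [NormedAddCommGroup H]
    [InnerProductSpace 𝕜 H] [CompleteSpace H] {n : ℕ} (e : Fin n → H)
    {M : Matrix (Fin n) (Fin n) 𝕜} (hM : star M = -M) :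
    star (∑ i, ∑ j, M i j • rankOne 𝕜 (e i) (e j)) = -∑ i, ∑ j, M i j • rankOne 𝕜 (e i) (e j) := by
  have hM' : ∀ i j, starRingEnd 𝕜 (M j i) = -M i j := fun i j => congrFun (congrFun hM i) j
  rw [star_sum, ← Finset.sum_neg_distrib, Finset.sum_congr rfl fun i _ => star_sum _ _,
    Finset.sum_comm]
  refine Finset.sum_congr rfl fun i _ => ?_
  rw [← Finset.sum_neg_distrib]
  refine Finset.sum_congr rfl fun j _ => ?_
  rw [star_smul, ContinuousLinearMap.star_eq_adjoint, adjoint_rankOne, RCLike.star_def, hM',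
    neg_smul]

/-- A solution `X` of `V² X = X`, `X V = -V X` is determined by the compression of `V X` to
`F₁ = F ∩ ker P`, where `F` is the fixed space of `V²`: if this compression is zero then `X`
vanishes on `F₁`, hence on `V F₁ = F ∩ ran P`, hence on `F`. As the range of `X` lies in `F`, this
gives `X² = 0`. -/
theorem eq_zero_of_inner_eq_zero {𝕜 H : Type*} [RCLike 𝕜] [NormedAddCommGroup H]
    [InnerProductSpace 𝕜 H] [CompleteSpace H] {P V X : H →L[𝕜] H} (hP : P * P = P)
    (hVc : V = V * P + P * V) (hXs : star X = X) (hXc : X = X * P + P * X)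
    (h1 : V * V * X = X) (h2 : X * V = -(V * X)) {ι : Type*} {e : ι → H}
    (he : ∀ i, P (e i) = 0) (hspan : ∀ x, V (V x) = x → P x = 0 →
      x ∈ Submodule.span 𝕜 (Set.range e))
    (h0 : ∀ i j, inner 𝕜 (e i) (V (X (e j))) = 0) : X = 0 := by
  have hPx : ∀ x, P (P x) = P x := fun x => congrArg (fun T : H →L[𝕜] H => T x) hP
  have hVx : ∀ x, V x = V (P x) + P (V x) := fun x => congrArg (fun T : H →L[𝕜] H => T x) hVc
  have hXx : ∀ x, X x = X (P x) + P (X x) := fun x => congrArg (fun T : H →L[𝕜] H => T x) hXc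
  have hVVX : ∀ x, V (V (X x)) = X x := fun x => congrArg (fun T : H →L[𝕜] H => T x) h1
  have hXV : ∀ x, X (V x) = -V (X x) := fun x => congrArg (fun T : H →L[𝕜] H => T x) h2
  have hPVV : ∀ x, P (V (V x)) = V (V (P x)) := fun x =>
    congrArg (fun T : H →L[𝕜] H => T x) (mul_mul_eq_of_codiagonal hVc)
  have hPVP : ∀ x, P x = x → P (V x) = 0 := fun x hx => by simpa [hx] using hVx x
  have hXe : ∀ j, X (e j) = 0 := fun j => by
    have h3 : P (X (e j)) = X (e j) := by simpa [he] using (hXx (e j)).symm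
    have h4 := hspan (V (X (e j))) (by rw [hVVX]) (hPVP _ h3)
    have h5 : Submodule.span 𝕜 (Set.range e) ≤ (Submodule.span 𝕜 {V (X (e j))})ᗮ := by
      rw [Submodule.span_le]
      rintro _ ⟨i, rfl⟩
      exact Submodule.mem_orthogonal_singleton_iff_inner_left.2 (h0 i j)
    have h6 : V (X (e j)) = 0 :=
      inner_self_eq_zero.1 (Submodule.mem_orthogonal_singleton_iff_inner_left.1 (h5 h4))
    rw [← hVVX, h6, map_zero]
  have hXF₁ : ∀ x, V (V x) = x → P x = 0 → X x = 0 := fun x hx1 hx2 => by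
    have h3 : Submodule.span 𝕜 (Set.range e) ≤ LinearMap.ker X.toLinearMap := by
      rw [Submodule.span_le]
      rintro _ ⟨i, rfl⟩
      exact hXe i
    exact h3 (hspan x hx1 hx2)
  have hXF : ∀ x, V (V x) = x → X x = 0 := fun x hx => by
    have hVVP : V (V (P x)) = P x := by rw [← hPVV, hx]
    have h3 : X (x - P x) = 0 :=
      hXF₁ _ (by rw [map_sub, map_sub, hx, hVVP]) (by rw [map_sub, hPx, sub_self])
    have h4 : X (P x) = 0 := by
      rw [← hVVP, hXV, hXF₁ _ (by rw [hVVP]) (hPVP _ (hPx x)), map_zero, neg_zero]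
    rwa [map_sub, h4, sub_zero] at h3
  ext x
  have h3 : inner 𝕜 (X x) (X x) = 0 := by
    rw [← ContinuousLinearMap.adjoint_inner_right, ← ContinuousLinearMap.star_eq_adjoint, hXs,
      hXF _ (hVVX x), inner_zero_right]
  exact inner_self_eq_zero.1 h3

theorem mem_fixedSpace_sq_inf_ker {𝕜 H : Type*} [RCLike 𝕜] [NormedAddCommGroup H]
    [InnerProductSpace 𝕜 H] {P V : H →L[𝕜] H} {x : H} :
    x ∈ fixedSpace (V ^ 2) ⊓ LinearMap.ker P.toLinearMap ↔ V (V x) = x ∧ P x = 0 := by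
  rw [Submodule.mem_inf, sq]
  rfl

theorem inner_mem_skewAdjoint_matrix {𝕜 H : Type*} [RCLike 𝕜] [NormedAddCommGroup H]
    [InnerProductSpace 𝕜 H] [CompleteSpace H] {V X : H →L[𝕜] H} (hVs : star V = V)
    (hXs : star X = X) (h : X * V = -(V * X)) {n : ℕ} (e : Fin n → H) :
    (Matrix.of fun i j => (inner 𝕜 (e i) (V (X (e j))) : 𝕜)) ∈
      skewAdjoint (Matrix (Fin n) (Fin n) 𝕜) := by
  rw [skewAdjoint.mem_iff]
  ext i j
  have h3 : X (V (e j)) = -V (X (e j)) := congrArg (fun T : H →L[𝕜] H => T (e j)) h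
  have h4 : inner 𝕜 (V (X (e i))) (e j) = inner 𝕜 (e i) (X (V (e j))) := by
    rw [← ContinuousLinearMap.adjoint_inner_right, ← ContinuousLinearMap.star_eq_adjoint, hVs,
      ← ContinuousLinearMap.adjoint_inner_right, ← ContinuousLinearMap.star_eq_adjoint, hXs]
  simp only [Matrix.star_apply, Matrix.of_apply, Matrix.neg_apply, RCLike.star_def,
    inner_conj_symm]
  rw [h4, h3, inner_neg_right]

/-- The matrix of `V X` with respect to the family `e`, as a real-linear function of a tangent
vector `X` that anticommutes with `V`. -/
def tangentMatrix {𝕜 H : Type*} [RCLike 𝕜] [NormedAddCommGroup H]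
    [InnerProductSpace 𝕜 H] [CompleteSpace H] {A : StarSubalgebra 𝕜 (H →L[𝕜] H)}
    [NormedAlgebra ℝ A] [StarModule ℝ A] [IsScalarTower ℝ 𝕜 A] {P : A} (V : tangentSpace P)
    (K : Submodule ℝ (tangentSpace P)) (hK : ∀ X ∈ K, (X : A) * V = -((V : A) * X))
    {n : ℕ} (e : Fin n → H) : K →ₗ[ℝ] skewAdjoint (Matrix (Fin n) (Fin n) 𝕜) where
  toFun X := ⟨_, inner_mem_skewAdjoint_matrix (V := ((V : A) : H →L[𝕜] H))
    (X := (((X : tangentSpace P) : A) : H →L[𝕜] H)) (congrArg Subtype.val V.2.1)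
    (congrArg Subtype.val (X : tangentSpace P).2.1) (congrArg Subtype.val (hK X X.2)) e⟩
  map_add' X Y := by
    ext i j
    simp [inner_add_right]
  map_smul' c X := by
    ext i j
    have h : ((c • ((X : tangentSpace P) : A) : A) : H →L[𝕜] H) (e j) =
        (c : 𝕜) • (((X : tangentSpace P) : A) : H →L[𝕜] H) (e j) := by
      have : c • ((X : tangentSpace P) : A) = (c : 𝕜) • ((X : tangentSpace P) : A) := by
        rw [RCLike.ofReal_alg, smul_assoc, one_smul]
      rw [this]
      rfl
    simp [h, inner_smul_right, RCLike.real_smul_eq_coe_mul]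

theorem coe_tangentMatrix_apply {𝕜 H : Type*} [RCLike 𝕜] [NormedAddCommGroup H]
    [InnerProductSpace 𝕜 H] [CompleteSpace H] {A : StarSubalgebra 𝕜 (H →L[𝕜] H)}
    [NormedAlgebra ℝ A] [StarModule ℝ A] [IsScalarTower ℝ 𝕜 A] {P : A} (V : tangentSpace P)
    (K : Submodule ℝ (tangentSpace P)) (hK : ∀ X ∈ K, (X : A) * V = -((V : A) * X))
    {n : ℕ} (e : Fin n → H) (X : K) (i j : Fin n) :
    (tangentMatrix V K hK e X : Matrix (Fin n) (Fin n) 𝕜) i j = inner 𝕜 (e i)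
      (((V : A) : H →L[𝕜] H) ((((X : tangentSpace P) : A) : H →L[𝕜] H) (e j))) := rfl

open InnerProductSpace in
/-- Any skew-adjoint matrix is the matrix of a skew-adjoint finite-rank operator on `F ∩ ker P`
belonging to the algebra, a combination of the rank-one operators. -/
theorem exists_star_eq_neg_mem {𝕜 H : Type*} [RCLike 𝕜] [NormedAddCommGroup H]
    [InnerProductSpace 𝕜 H] [CompleteSpace H] {A : StarSubalgebra 𝕜 (H →L[𝕜] H)}
    {P V : H →L[𝕜] H}
    (hA : ∀ ξ ∈ fixedSpace (V ^ 2), ∀ η ∈ fixedSpace (V ^ 2), rankOne 𝕜 ξ η ∈ A)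
    {n : ℕ} {e : Fin n → H} (he : Orthonormal 𝕜 e)
    (heF : ∀ i, e i ∈ fixedSpace (V ^ 2) ⊓ LinearMap.ker P.toLinearMap)
    {M : Matrix (Fin n) (Fin n) 𝕜} (hM : star M = -M) :
    ∃ b ∈ A, star b = -b ∧ P * b = 0 ∧ V * V * b = b ∧
      ∀ i j, inner 𝕜 (e i) (b (e j)) = M i j := by
  classical
  have hx : ∀ x, (∑ i, ∑ j, M i j • rankOne 𝕜 (e i) (e j)) x =
      ∑ i, ∑ j, M i j • (inner 𝕜 (e j) x : 𝕜) • e i := fun x => by simp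
  have heV := fun i => (mem_fixedSpace_sq_inf_ker.1 (heF i)).1
  have heP := fun i => (mem_fixedSpace_sq_inf_ker.1 (heF i)).2
  refine ⟨∑ i, ∑ j, M i j • rankOne 𝕜 (e i) (e j), sum_mem fun i _ => sum_mem fun j _ =>
    SMulMemClass.smul_mem _ (hA _ (heF i).1 _ (heF j).1), star_sum_smul_rankOne e hM, ?_, ?_, ?_⟩
  · ext x
    rw [mul_apply_eq_comp, hx]
    simp [heP]
  · ext x
    rw [mul_apply_eq_comp, mul_apply_eq_comp, hx]
    simp [heV]
  · intro i j
    rw [hx]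
    simp [inner_sum, inner_smul_right, orthonormal_iff_ite.1 he]

set_option maxHeartbeats 400000 in
open InnerProductSpace in
/-- The matrix of `b` is attained at `X = V b - b V`. -/
theorem tangentMatrix_surjective {𝕜 H : Type*} [RCLike 𝕜] [NormedAddCommGroup H]
    [InnerProductSpace 𝕜 H] [CompleteSpace H] {A : StarSubalgebra 𝕜 (H →L[𝕜] H)}
    [NormedAlgebra ℝ A] [StarModule ℝ A] [IsScalarTower ℝ 𝕜 A] {P : A} (hP : IsStarProjection P)
    (V : tangentSpace P)
    (hA : ∀ ξ ∈ fixedSpace (((V : A) : H →L[𝕜] H) ^ 2),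
      ∀ η ∈ fixedSpace (((V : A) : H →L[𝕜] H) ^ 2), rankOne 𝕜 ξ η ∈ A)
    (K : Submodule ℝ (tangentSpace P)) (hK : ∀ X ∈ K, (X : A) * V = -((V : A) * X))
    (hK' : ∀ X : tangentSpace P, (V : A) * V * X = X → (X : A) * V = -((V : A) * X) → X ∈ K)
    {n : ℕ} {e : Fin n → H} (he : Orthonormal 𝕜 e)
    (heF : ∀ i, e i ∈ fixedSpace (((V : A) : H →L[𝕜] H) ^ 2) ⊓
      LinearMap.ker (P : H →L[𝕜] H).toLinearMap) :
    Function.Surjective (tangentMatrix V K hK e) := fun M => by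
  obtain ⟨B, hBA, hBs, hPB, hVVB, hBe⟩ :=
    exists_star_eq_neg_mem hA he heF (skewAdjoint.mem_iff.1 M.2)
  lift B to A using hBA with b
  have hbs : star b = -b := Subtype.ext hBs
  have hPb : P * b = 0 := Subtype.ext hPB
  have hVVb : (V : A) * V * b = b := Subtype.ext hVVB
  obtain ⟨h1, h2⟩ := mul_commutator_eq V.2.1 hbs hVVb
  have h3 := mul_mul_commutator_eq hP.isSelfAdjoint V.2.2 hbs hPb hVVb
  refine ⟨⟨⟨_, commutator_mem_tangentSpace hP V hbs hPb⟩, hK' _ h1 h2⟩, ?_⟩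
  ext k l
  have h4 : (P : H →L[𝕜] H) (e l) = 0 := (mem_fixedSpace_sq_inf_ker.1 (heF l)).2
  have h5 : ((V : A) : H →L[𝕜] H) (((V * b - b * V : A) : H →L[𝕜] H) (e l)) =
      (b : H →L[𝕜] H) (e l) -
        ((V * b * V : A) : H →L[𝕜] H) ((P : H →L[𝕜] H) (e l)) :=
    congrArg (fun T : A => (T : H →L[𝕜] H) (e l)) h3
  rw [h4, map_zero, sub_zero] at h5
  rw [coe_tangentMatrix_apply, ← hBe, ← h5]

theorem tangentMatrix_injective {𝕜 H : Type*} [RCLike 𝕜] [NormedAddCommGroup H]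
    [InnerProductSpace 𝕜 H] [CompleteSpace H] {A : StarSubalgebra 𝕜 (H →L[𝕜] H)}
    [NormedAlgebra ℝ A] [StarModule ℝ A] [IsScalarTower ℝ 𝕜 A] {P : A} (hP : IsStarProjection P)
    (V : tangentSpace P)
    (K : Submodule ℝ (tangentSpace P)) (hK : ∀ X ∈ K, (X : A) * V = -((V : A) * X))
    (hK' : ∀ X ∈ K, (V : A) * V * X = X)
    {n : ℕ} {e : Fin n → H}
    (heF : ∀ i, e i ∈ fixedSpace (((V : A) : H →L[𝕜] H) ^ 2) ⊓
      LinearMap.ker (P : H →L[𝕜] H).toLinearMap)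
    (hspan : fixedSpace (((V : A) : H →L[𝕜] H) ^ 2) ⊓ LinearMap.ker (P : H →L[𝕜] H).toLinearMap ≤
      Submodule.span 𝕜 (Set.range e)) :
    Function.Injective (tangentMatrix V K hK e) := by
  rw [← LinearMap.ker_eq_bot, LinearMap.ker_eq_bot']
  intro X hX
  refine Subtype.ext (Subtype.ext (Subtype.ext ?_))
  refine eq_zero_of_inner_eq_zero (P := (P : H →L[𝕜] H)) (V := ((V : A) : H →L[𝕜] H)) (e := e)
    (congrArg Subtype.val (hP.isIdempotentElem : P * P = P)) (congrArg Subtype.val V.2.2)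
    (congrArg Subtype.val (X : tangentSpace P).2.1)
    (congrArg Subtype.val (X : tangentSpace P).2.2) (congrArg Subtype.val (hK' X X.2))
    (congrArg Subtype.val (hK X X.2)) (fun i => (mem_fixedSpace_sq_inf_ker.1 (heF i)).2)
    (fun x h1 h2 => hspan (mem_fixedSpace_sq_inf_ker.2 ⟨h1, h2⟩)) (fun i j => ?_)
  rw [← coe_tangentMatrix_apply V K hK e X, hX]
  rfl

/-! ### The order of the conjugate point -/

theorem mem_ker_fderiv_expMap_iff {𝕜 H : Type*} [RCLike 𝕜] [NormedAddCommGroup H]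
    [InnerProductSpace 𝕜 H] [CompleteSpace H] {A : StarSubalgebra 𝕜 (H →L[𝕜] H)}
    [NormedAlgebra ℝ A] [StarModule ℝ A] [IsScalarTower ℝ 𝕜 A]
    (hA : IsClosed (A : Set (H →L[𝕜] H))) {P : A} (hP : IsStarProjection P)
    {V : tangentSpace P} (hV : ‖V‖ ≤ 1) (X : tangentSpace P) :
    X ∈ LinearMap.ker (fderiv ℝ (expMap P) ((Real.pi / 2) • V)).toLinearMap ↔
      (V : A) * V * X = X ∧ (X : A) * V = -((V : A) * X) := by
  have : CompleteSpace A := hA.completeSpace_coe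
  have h4 : (4 : ℝ) • (X : A) = (4 : 𝕜) • (X : A) := by
    rw [← RCLike.ofReal_ofNat (K := 𝕜) 4, RCLike.ofReal_alg, smul_assoc, one_smul]
  have h := double_commutator_eq_iff (V := ((V : A) : H →L[𝕜] H)) (X := ((X : A) : H →L[𝕜] H))
    (congrArg Subtype.val V.2.1) hV
  refine (fderiv_expMap_pi_div_two_smul_eq_zero_iff hP hV X).trans ?_
  rw [h4]
  exact (Subtype.ext_iff.trans h).trans (and_congr Subtype.ext_iff.symm Subtype.ext_iff.symm)

theorem toENat_rank_skewAdjoint_matrix (𝕜 : Type*) [RCLike 𝕜] (n : ℕ) :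
    Cardinal.toENat (Module.rank ℝ (skewAdjoint (Matrix (Fin n) (Fin n) 𝕜))) =
      Module.finrank ℝ (skewAdjoint (Matrix (Fin n) (Fin n) 𝕜)) := by
  have : Module.Finite ℝ (skewAdjoint.submodule ℝ (Matrix (Fin n) (Fin n) 𝕜)) := inferInstance
  have : Module.Finite ℝ (skewAdjoint (Matrix (Fin n) (Fin n) 𝕜)) := this
  rw [← Module.finrank_eq_rank, Cardinal.toENat_nat]

open InnerProductSpace in
theorem natCast_finrank_le_conjugateOrder {𝕜 H : Type*} [RCLike 𝕜] [NormedAddCommGroup H]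
    [InnerProductSpace 𝕜 H] [CompleteSpace H] {A : StarSubalgebra 𝕜 (H →L[𝕜] H)}
    [NormedAlgebra ℝ A] [StarModule ℝ A] [IsScalarTower ℝ 𝕜 A]
    (hA : IsClosed (A : Set (H →L[𝕜] H))) {P : A} (hP : IsStarProjection P)
    {V : tangentSpace P} (hV : ‖V‖ ≤ 1)
    (hF : ∀ ξ ∈ fixedSpace (((V : A) : H →L[𝕜] H) ^ 2),
      ∀ η ∈ fixedSpace (((V : A) : H →L[𝕜] H) ^ 2), rankOne 𝕜 ξ η ∈ A)
    {n : ℕ} {e : Fin n → H} (he : Orthonormal 𝕜 e)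
    (heF : ∀ i, e i ∈ fixedSpace (((V : A) : H →L[𝕜] H) ^ 2) ⊓
      LinearMap.ker (P : H →L[𝕜] H).toLinearMap) :
    (Module.finrank ℝ (skewAdjoint (Matrix (Fin n) (Fin n) 𝕜)) : ℕ∞) ≤
      conjugateOrder P ((Real.pi / 2) • V) := by
  have hK := mem_ker_fderiv_expMap_iff hA hP hV
  obtain ⟨g, hg⟩ := LinearMap.exists_rightInverse_of_surjective
    (tangentMatrix V _ (fun X hX => ((hK X).1 hX).2) e)
    (LinearMap.range_eq_top.2 (tangentMatrix_surjective hP V hF _ _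
      (fun X h1 h2 => (hK X).2 ⟨h1, h2⟩) he heF))
  have hinj : Function.Injective g := LinearMap.injective_of_comp_eq_id _ _ hg
  have h := OrderHomClass.mono Cardinal.toENat (LinearMap.lift_rank_le_of_injective g hinj)
  rw [Cardinal.toENat_lift, Cardinal.toENat_lift] at h
  rwa [toENat_rank_skewAdjoint_matrix] at h

open InnerProductSpace in
theorem conjugateOrder_eq_natCast_finrank {𝕜 H : Type*} [RCLike 𝕜] [NormedAddCommGroup H]
    [InnerProductSpace 𝕜 H] [CompleteSpace H] {A : StarSubalgebra 𝕜 (H →L[𝕜] H)}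
    [NormedAlgebra ℝ A] [StarModule ℝ A] [IsScalarTower ℝ 𝕜 A]
    (hA : IsClosed (A : Set (H →L[𝕜] H))) {P : A} (hP : IsStarProjection P)
    {V : tangentSpace P} (hV : ‖V‖ ≤ 1)
    (hF : ∀ ξ ∈ fixedSpace (((V : A) : H →L[𝕜] H) ^ 2),
      ∀ η ∈ fixedSpace (((V : A) : H →L[𝕜] H) ^ 2), rankOne 𝕜 ξ η ∈ A)
    {n : ℕ} {e : Fin n → H} (he : Orthonormal 𝕜 e)
    (heF : ∀ i, e i ∈ fixedSpace (((V : A) : H →L[𝕜] H) ^ 2) ⊓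
      LinearMap.ker (P : H →L[𝕜] H).toLinearMap)
    (hspan : fixedSpace (((V : A) : H →L[𝕜] H) ^ 2) ⊓ LinearMap.ker (P : H →L[𝕜] H).toLinearMap ≤
      Submodule.span 𝕜 (Set.range e)) :
    conjugateOrder P ((Real.pi / 2) • V) =
      Module.finrank ℝ (skewAdjoint (Matrix (Fin n) (Fin n) 𝕜)) := by
  refine le_antisymm ?_ (natCast_finrank_le_conjugateOrder hA hP hV hF he heF)
  have hK := mem_ker_fderiv_expMap_iff hA hP hV
  have h := OrderHomClass.mono Cardinal.toENat (LinearMap.lift_rank_le_of_injective _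
    (tangentMatrix_injective hP V _ (fun X hX => ((hK X).1 hX).2) (fun X hX => ((hK X).1 hX).1)
      heF hspan))
  rw [Cardinal.toENat_lift, Cardinal.toENat_lift] at h
  rwa [toENat_rank_skewAdjoint_matrix] at h

open InnerProductSpace in
/-- If `F ∩ ker P` has dimension `n < ∞`, an orthonormal basis identifies the kernel with the
skew-adjoint `n × n` matrices; if the dimension is infinite, there are orthonormal families of
every length. -/
theorem conjugateOrder_dichotomy {𝕜 H : Type*} [RCLike 𝕜] [NormedAddCommGroup H]
    [InnerProductSpace 𝕜 H] [CompleteSpace H] {A : StarSubalgebra 𝕜 (H →L[𝕜] H)}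
    [NormedAlgebra ℝ A] [StarModule ℝ A] [IsScalarTower ℝ 𝕜 A]
    (hA : IsClosed (A : Set (H →L[𝕜] H))) {P : A} (hP : IsStarProjection P)
    {V : tangentSpace P} (hV : ‖V‖ ≤ 1)
    (hF : ∀ ξ ∈ fixedSpace (((V : A) : H →L[𝕜] H) ^ 2),
      ∀ η ∈ fixedSpace (((V : A) : H →L[𝕜] H) ^ 2), rankOne 𝕜 ξ η ∈ A) :
    (∃ n : ℕ, eDim (fixedSpace (((V : A) : H →L[𝕜] H) ^ 2) ⊓
        LinearMap.ker (P : H →L[𝕜] H).toLinearMap) = n ∧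
      conjugateOrder P ((Real.pi / 2) • V) =
        Module.finrank ℝ (skewAdjoint (Matrix (Fin n) (Fin n) 𝕜))) ∨
    (eDim (fixedSpace (((V : A) : H →L[𝕜] H) ^ 2) ⊓
        LinearMap.ker (P : H →L[𝕜] H).toLinearMap) = ⊤ ∧
      ∀ n : ℕ, (Module.finrank ℝ (skewAdjoint (Matrix (Fin n) (Fin n) 𝕜)) : ℕ∞) ≤
        conjugateOrder P ((Real.pi / 2) • V)) := by
  set F₁ := fixedSpace (((V : A) : H →L[𝕜] H) ^ 2) ⊓
    LinearMap.ker (P : H →L[𝕜] H).toLinearMap with hF₁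
  by_cases hfin : Module.Finite 𝕜 F₁
  · refine .inl ⟨Module.finrank 𝕜 F₁, ?_, ?_⟩
    · rw [eDim, ← Module.finrank_eq_rank, Cardinal.toENat_nat]
    · have b := stdOrthonormalBasis 𝕜 F₁
      refine conjugateOrder_eq_natCast_finrank hA hP hV hF (e := fun i => (b i : H))
        (b.orthonormal.comp_linearIsometry F₁.subtypeₗᵢ) (fun i => (b i).2) (fun x hx => ?_)
      have h1 : (⟨x, hx⟩ : F₁) ∈ Submodule.span 𝕜 (Set.range b) := by
        rw [← OrthonormalBasis.coe_toBasis, b.toBasis.span_eq]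
        trivial
      have h2 := Submodule.mem_map_of_mem (f := F₁.subtype) h1
      rw [Submodule.map_span, ← Set.range_comp] at h2
      exact h2
  · have hrank : Cardinal.aleph0 ≤ Module.rank 𝕜 F₁ := by
      rw [← not_lt, Module.rank_lt_aleph0_iff]
      exact hfin
    refine .inr ⟨by rwa [eDim, Cardinal.toENat_eq_top], fun n => ?_⟩
    obtain ⟨v, hv⟩ := Module.le_rank_iff.1 ((Cardinal.natCast_le_aleph0 (n := n)).trans hrank)
    exact natCast_finrank_le_conjugateOrder hA hP hV hF
      ((gramSchmidtNormed_orthonormal hv).comp_linearIsometry F₁.subtypeₗᵢ)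
      (fun i => (gramSchmidtNormed 𝕜 v i).2)

theorem differentiableAt_expMap {𝕜 H : Type*} [RCLike 𝕜] [NormedAddCommGroup H]
    [InnerProductSpace 𝕜 H] [CompleteSpace H] {A : StarSubalgebra 𝕜 (H →L[𝕜] H)}
    [NormedAlgebra ℝ A] [StarModule ℝ A] (hA : IsClosed (A : Set (H →L[𝕜] H))) {P : A}
    (hP : IsStarProjection P) (V : tangentSpace P) : DifferentiableAt ℝ (expMap P) V := by
  have : CompleteSpace A := hA.completeSpace_coe
  exact (hasFDerivAt_expMap hP.isIdempotentElem V).differentiableAt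

theorem mainTheorem2 :
    -- complex Grassmannians
    (∀ (H : Type*) [NormedAddCommGroup H] [InnerProductSpace ℂ H] [CompleteSpace H]
      (A : StarSubalgebra ℂ (H →L[ℂ] H)), IsClosed (A : Set (H →L[ℂ] H)) →
      ∀ (P : A), IsStarProjection P → ∀ (V : tangentSpace P), ‖V‖ = 1 →
      ∀ (U W : H →L[ℂ] H), IsPolarDecomposition ((V : A) : H →L[ℂ] H) U W → U ∈ A →
      (∀ ξ ∈ fixedSpace (((V : A) : H →L[ℂ] H) ^ 2),
        ∀ η ∈ fixedSpace (((V : A) : H →L[ℂ] H) ^ 2), InnerProductSpace.rankOne ℂ ξ η ∈ A) →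
      DifferentiableAt ℝ (expMap P) ((Real.pi / 2) • V) ∧
      ∃ d : ℕ∞,
        eDim (fixedSpace (((V : A) : H →L[ℂ] H) ^ 2)) = 2 * d ∧
        eDim (fixedSpace (((V : A) : H →L[ℂ] H) ^ 2) ⊓
          LinearMap.ker (P : H →L[ℂ] H).toLinearMap) = d ∧
        conjugateOrder P ((Real.pi / 2) • V) = d ^ 2) ∧
    -- real Grassmannians
    (∀ (H : Type*) [NormedAddCommGroup H] [InnerProductSpace ℝ H] [CompleteSpace H]
      (A : StarSubalgebra ℝ (H →L[ℝ] H)), IsClosed (A : Set (H →L[ℝ] H)) →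
      ∀ (P : A), IsStarProjection P → ∀ (V : tangentSpace P), ‖V‖ = 1 →
      ∀ (U W : H →L[ℝ] H), IsPolarDecomposition ((V : A) : H →L[ℝ] H) U W → U ∈ A →
      (∀ ξ ∈ fixedSpace (((V : A) : H →L[ℝ] H) ^ 2),
        ∀ η ∈ fixedSpace (((V : A) : H →L[ℝ] H) ^ 2), InnerProductSpace.rankOne ℝ ξ η ∈ A) →
      DifferentiableAt ℝ (expMap P) ((Real.pi / 2) • V) ∧
      ∃ d : ℕ∞,
        eDim (fixedSpace (((V : A) : H →L[ℝ] H) ^ 2)) = 2 * d ∧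
        eDim (fixedSpace (((V : A) : H →L[ℝ] H) ^ 2) ⊓
          LinearMap.ker (P : H →L[ℝ] H).toLinearMap) = d ∧
        2 * conjugateOrder P ((Real.pi / 2) • V) = d * (d - 1)) := by

  refine ⟨?_, ?_⟩
  · intro H _ _ _ A hA P hP V hV U W _ _ hF
    refine ⟨differentiableAt_expMap hA hP _, eDim (fixedSpace (((V : A) : H →L[ℂ] H) ^ 2) ⊓
      LinearMap.ker (P : H →L[ℂ] H).toLinearMap),
      eDim_fixedSpace_sq (congrArg Subtype.val (hP.isIdempotentElem : P * P = P))
        (congrArg Subtype.val V.2.2), rfl, ?_⟩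
    rcases conjugateOrder_dichotomy hA hP hV.le hF with ⟨n, h1, h2⟩ | ⟨h1, h2⟩
    · rw [h1, h2, finrank_skewAdjoint_matrix_complex]
      norm_cast
    · rw [h1, ENat.top_pow two_ne_zero]
      refine ENat.eq_top_iff_forall_ge.2 fun n => le_trans ?_ (h2 n)
      rw [finrank_skewAdjoint_matrix_complex]
      exact_mod_cast Nat.le_self_pow two_ne_zero n
  · intro H _ _ _ A hA P hP V hV U W _ _ hF
    refine ⟨differentiableAt_expMap hA hP _, eDim (fixedSpace (((V : A) : H →L[ℝ] H) ^ 2) ⊓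
      LinearMap.ker (P : H →L[ℝ] H).toLinearMap),
      eDim_fixedSpace_sq (congrArg Subtype.val (hP.isIdempotentElem : P * P = P))
        (congrArg Subtype.val V.2.2), rfl, ?_⟩
    have : IsScalarTower ℝ ℝ A := ⟨fun a b c => smul_assoc a b c⟩
    rcases conjugateOrder_dichotomy hA hP hV.le hF with ⟨n, h1, h2⟩ | ⟨h1, h2⟩
    · rw [h1, h2]
      exact_mod_cast two_mul_finrank_skewAdjoint_matrix_real n
    · have h3 : conjugateOrder P ((Real.pi / 2) • V) = ⊤ := by
        refine ENat.eq_top_iff_forall_ge.2 fun n => le_trans ?_ (h2 (n + 3))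
        have h4 := two_mul_finrank_skewAdjoint_matrix_real (n + 3)
        rw [Nat.cast_le]
        rw [show n + 3 - 1 = n + 2 by omega] at h4
        nlinarith
      rw [h1, h3]
      rfl
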